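/- Let $\mathcal G_0$ be the set of right-continuous nondecreasing functions $g:[0,1]\to[0,1]$ with $g(1)=1$, equipped with the metric $d^{L^2}(f,g)=\|f-g\|_{L^2([0,1])}$ and its Borel $\sigma$-algebra. For $\beta>0$, the entropic measure $\mathbb Q^\beta_0$ is the Borel probability measure on $\mathcal G_0$ such that for every partition $0=t_0<t_1<\dots<t_N<t_{N+1}=1$ and every bounded measurable $u:\mathbb R^N\to\mathbb R$, $$\int_{\mathcal G_0}u(g(t_1),\dots,g(t_N))\,d\mathbb Q^\beta_0(g)=\frac{\Gamma(\beta)}{\prod_{i=0}^N\Gamma(\beta(t_{i+1}-t_i))}\int_{\Sigma_N}u(x_1,\dots,x_N)\prod_{i=0}^N(x_{i+1}-x_i)^{\beta(t_{i+1}-t_i)-1}\,dx_1\cdots dx_N,$$ where $\Sigma_N=\{(x_1,\dots,x_N): 0=x_0<x_1<\dots<x_N<x_{N+1}=1\}$. For a Borel probability measure $m$ on a bounded metric space $(X,d)$, let $d^W(\mu,\nu)^2=\inf_\pi\int_{X\times X}d(x,y)^2\,d\pi(x,y)$ over all probability measures $\pi$ on $X\times X$ with marginals $\mu$ and $\nu$,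 and let $\mathrm{Ent}(\mu|m)=\int_X\rho\log\rho\,dm$ if $\mu=\rho m$ and $\mathrm{Ent}(\mu|m)=+\infty$ if $\mu\not\ll m$. One says that $(X,d,m)$ has generalized $\mathrm{Ric}\ge K$ if for all Borel probability measures $\mu_0,\mu_1\ll m$ there is a constant speed $d^W$-geodesic $(\mu_t)_{t\in[0,1]}$ of Borel probability measures from $\mu_0$ to $\mu_1$ (that is, $d^W(\mu_s,\mu_t)=|s-t|\,d^W(\mu_0,\mu_1)$ for all $s,t\in[0,1]$) such that for all $t\in[0,1]$ $$\mathrm{Ent}(\mu_t|m)\le t\,\mathrm{Ent}(\mu_1|m)+(1-t)\,\mathrm{Ent}(\mu_0|m)-\tfrac K2\,t(1-t)\,d^W(\mu_0,\mu_1)^2,$$ with the convention $0\cdot\infty=0$. **Theorem.** Let $\beta>0$. A probability measure $\mathbb Q^\beta_0$ as above exists, and for every such measure there is no $K\in\mathbb R$ for which $(\mathcal G_0,d^{L^2},\mathbb Q^\beta_0)$ has generalized $\mathrm{Ric}\ge K$. -/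

import Mathlib

open MeasureTheory Set Filter Topology
open scoped ENNReal unitInterval

noncomputable section

/-- Right-continuous nondecreasing functions `g : [0,1] → [0,1]` with `g 1 = 1`. (Without the
normalisation at the right end point the `L²` distance would not separate points.) -/
structure MonotoneFun where
  toFun : I → I
  monotone' : Monotone toFun
  rightCont' : ∀ t : I, ContinuousWithinAt toFun (Ici t) t
  map_one' : toFun 1 = 1

namespace MonotoneFun

instance : CoeFun MonotoneFun (fun _ => I → I) := ⟨MonotoneFun.toFun⟩

theorem memLp (g : MonotoneFun) : MemLp (fun x : I => (g x : ℝ)) 2 (volume : Measure I) := by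
  refine MemLp.of_bound ?_ 1 ?_
  · exact (measurable_subtype_coe.comp g.monotone'.measurable).aestronglyMeasurable
  · refine Eventually.of_forall fun x => ?_
    rw [Real.norm_eq_abs, abs_of_nonneg (g x).2.1]
    exact (g x).2.2

/-- The class of `g` in `L²([0,1])`. -/
def toL2 (g : MonotoneFun) : Lp ℝ 2 (volume : Measure I) := g.memLp.toLp _

theorem toL2_injective : Function.Injective toL2 := by
  intro f g h
  have hae : (fun x : I => (f x : ℝ)) =ᵐ[volume] fun x : I => (g x : ℝ) :=
    (MemLp.toLp_eq_toLp_iff f.memLp g.memLp).1 h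
  suffices hfg : f.toFun = g.toFun by
    cases f; cases g; cases hfg; rfl
  funext t
  rcases eq_or_lt_of_le t.2.2 with ht | ht
  · have : t = 1 := Subtype.ext ht
    rw [this, f.map_one', g.map_one']
  · have ht1 : t < 1 := ht
    have hfr : ∃ᶠ x in 𝓝[>] t, (f x : ℝ) = (g x : ℝ) := by
      rw [(nhdsGT_basis_of_exists_gt ⟨1, ht1⟩).frequently_iff]
      intro b hb
      by_contra hne
      push Not at hne
      have h0 : (volume : Measure I) (Ioo t b) = 0 :=
        measure_mono_null (fun x hx => hne x hx) hae
      rw [unitInterval.volume_Ioo, ENNReal.ofReal_eq_zero] at h0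
      have : (t : ℝ) < b := hb
      linarith
    set S : Set I := {x : I | (f x : ℝ) = (g x : ℝ)} with hS
    have hne : (𝓝[>] t ⊓ 𝓟 S).NeBot := frequently_mem_iff_neBot.1 hfr
    have hle : 𝓝[>] t ⊓ 𝓟 S ≤ 𝓝[≥] t :=
      inf_le_left.trans (nhdsWithin_mono _ Ioi_subset_Ici_self)
    have hf : Tendsto f.toFun (𝓝[>] t ⊓ 𝓟 S) (𝓝 (f t)) := (f.rightCont' t).mono_left hle
    have hg : Tendsto g.toFun (𝓝[>] t ⊓ 𝓟 S) (𝓝 (g t)) := (g.rightCont' t).mono_left hle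
    refine tendsto_nhds_unique (hf.congr' ?_) hg
    filter_upwards [mem_inf_of_right (mem_principal_self S)] with x hx
    exact Subtype.ext hx

/-- The metric `d^{L²}` induced from `L²([0,1])`. -/
instance : MetricSpace MonotoneFun := MetricSpace.induced toL2 toL2_injective inferInstance

instance : MeasurableSpace MonotoneFun := borel MonotoneFun

instance : BorelSpace MonotoneFun := ⟨rfl⟩

end MonotoneFun

section Entropic

/-- The point `(x₁, …, x_N)` extended by `x₀ = 0` and `x_{N+1} = 1`. -/
def extendEnds {N : ℕ} (x : Fin N → ℝ) : Fin (N + 2) → ℝ :=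
  Fin.cons 0 (Fin.snoc (α := fun _ => ℝ) x 1 : Fin (N + 1) → ℝ)

/-- The set of `(x₁, …, x_N)` with `0 = x₀ < x₁ < ⋯ < x_N < x_{N+1} = 1`. -/
def openSimplex (N : ℕ) : Set (Fin N → ℝ) := {x | StrictMono (extendEnds x)}

/-- `Q` is the entropic measure (Dirichlet process) with parameter `β`: for every partition
`0 = t₀ < t₁ < ⋯ < t_N < t_{N+1} = 1` and every bounded measurable `u`,
`∫ u(g(t₁), …, g(t_N)) dQ(g)` equals
`Γ(β) / ∏ Γ(β(t_{i+1} - t_i)) * ∫_{Σ_N} u(x) ∏ (x_{i+1} - x_i)^{β(t_{i+1} - t_i) - 1} dx`. -/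
def IsEntropicMeasure (β : ℝ) (Q : ProbabilityMeasure MonotoneFun) : Prop :=
  ∀ (N : ℕ) (t : Fin (N + 2) → I), StrictMono t → t 0 = 0 → t (Fin.last (N + 1)) = 1 →
    ∀ u : (Fin N → ℝ) → ℝ, Measurable u → (∃ C : ℝ, ∀ x, |u x| ≤ C) →
      ∫ g : MonotoneFun, u (fun i : Fin N => (g (t i.succ.castSucc) : ℝ))
          ∂(Q : Measure MonotoneFun) =
        Real.Gamma β / (∏ i : Fin (N + 1), Real.Gamma (β * ((t i.succ : ℝ) - t i.castSucc))) *
          ∫ x in openSimplex N, u x * ∏ i : Fin (N + 1),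
            (extendEnds x i.succ - extendEnds x i.castSucc) ^
              (β * ((t i.succ : ℝ) - t i.castSucc) - 1)

end Entropic

section Ricci

variable {X : Type*} [MeasurableSpace X]

/-- Transport plans: measures on `X × X` with first marginal `μ` and second marginal `ν`. -/
def transportPlans (μ ν : ProbabilityMeasure X) : Set (ProbabilityMeasure (X × X)) :=
  {π | (π : Measure (X × X)).map Prod.fst = (μ : Measure X) ∧
    (π : Measure (X × X)).map Prod.snd = (ν : Measure X)}

/-- The `2`-Wasserstein distance (on a bounded metric space, where the infimum is finite):
`d^W(μ,ν)² = inf_π ∫ d(x,y)² dπ(x,y)`. -/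
def wassersteinDist [MetricSpace X] (μ ν : ProbabilityMeasure X) : ℝ :=
  √(⨅ π ∈ transportPlans μ ν, ∫⁻ p : X × X, edist p.1 p.2 ^ 2 ∂(π : Measure (X × X))).toReal

/-- Constant speed geodesics `[0,1] → P(X)` for the Wasserstein distance. -/
def IsWassersteinGeodesic [MetricSpace X] (γ : I → ProbabilityMeasure X) : Prop :=
  ∀ s t : I, wassersteinDist (γ s) (γ t) = |(s : ℝ) - t| * wassersteinDist (γ 0) (γ 1)

open Classical in
/-- `Ent(μ|m) = ∫ ρ log ρ dm` if `μ = ρ m`, and `+∞` if `μ` is not absolutely continuous with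
respect to `m`. As `ρ log ρ` is bounded below, the integral is `+∞` when `ρ log ρ` is not
integrable. -/
def relEntropy (μ m : ProbabilityMeasure X) : EReal :=
  let ρ : X → ℝ := fun x => ((μ : Measure X).rnDeriv (m : Measure X) x).toReal
  if (μ : Measure X) ≪ (m : Measure X) ∧
      Integrable (fun x => ρ x * Real.log (ρ x)) (m : Measure X) then
    ((∫ x, ρ x * Real.log (ρ x) ∂(m : Measure X) : ℝ) : EReal)
  else ⊤

/-- Generalized `Ric ≥ K` for `(X, d, m)`: the entropy `Ent(·|m)` is weakly a.c. displacement
`K`-convex. The products in `EReal` satisfy `0 * ⊤ = 0`. -/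
def HasGeneralizedRicciGE [MetricSpace X] (m : ProbabilityMeasure X) (K : ℝ) : Prop :=
  ∀ μ₀ μ₁ : ProbabilityMeasure X,
    (μ₀ : Measure X) ≪ (m : Measure X) → (μ₁ : Measure X) ≪ (m : Measure X) →
      ∃ γ : I → ProbabilityMeasure X, γ 0 = μ₀ ∧ γ 1 = μ₁ ∧ IsWassersteinGeodesic γ ∧
        ∀ t : I, relEntropy (γ t) m ≤
          ((t : ℝ) : EReal) * relEntropy μ₁ m + ((1 - (t : ℝ) : ℝ) : EReal) * relEntropy μ₀ m -
            ((K / 2 * t * (1 - t) * wassersteinDist μ₀ μ₁ ^ 2 : ℝ) : EReal)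

end Ricci

end

/-! No bound: let `Q` be an entropic measure, `A = {g(s) ≥ 3/4}`, and consider a geodesic from `Q`
conditioned on `A`, whose entropy is `-log Q(A)`, to `Q` itself, whose entropy is `0`. The space
lies isometrically in the Hilbert space `L²`, where the parallelogram law forces a Wasserstein
midpoint to be coupled, up to a small error, with the midpoints of pairs of end points. The average
over `(s, 2s)` is at least `3/4` at one end and nonnegative at the other, so it is at least `3/8` at
the midpoint (`ae_le_of_wasserstein_midpoint`), and by monotonicity `g(2s) ≥ 3/8` there. A measure
carried by a set of mass at most `q` has entropy at least `-log q` (`neg_log_le_of_relEntropy_le`).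
Convexity at time `1/2`, with distances at most `1`, then gives `Q(A) ≤ exp(|K|/4) q²` whenever
`Q(g(2s) ≥ 3/8) ≤ q` (`HasGeneralizedRicciGE.measureReal_le`). But `g(s)` has a Beta law with
parameters `βs` and `β(1-s)`, so `Q(A)` is at least a constant times `s`, while `q` may be taken of
order `s`. Letting `s → 0` contradicts the quadratic estimate.

Existence: break a unit stick with independent `Beta(1, β)` proportions and put the pieces at
independent uniform locations; `Q` is the law of the resulting distribution function. Splitting off
the first piece shows that its values at the partition points have a law fixed by the operation
"move a `Beta(1, β)` proportion of the mass to a uniform location". The Dirichlet law is also fixed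
(`stationary_dirichletMeasure`), and the operation contracts on average, so the two agree
(`eq_of_stationary`). -/

namespace MeasureTheory.Measure

/-! ### Gluing of plans and Wasserstein midpoints. -/

/-- Two measures on products which share a marginal `ν` can be glued along a countable measurable
partition, so that the two copies of the shared coordinate lie in the same cell. -/
theorem exists_glue_partition {X Y Z : Type*} [MeasurableSpace X] [MeasurableSpace Y]
    [MeasurableSpace Z] (μ : Measure (X × Y)) (ν : Measure (Y × Z)) [IsFiniteMeasure μ]
    [IsFiniteMeasure ν] (h : μ.map Prod.snd = ν.map Prod.fst) (B : ℕ → Set Y)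
    (hB : ∀ k, MeasurableSet (B k)) (hd : Pairwise (Function.onFun Disjoint B))
    (hU : ⋃ k, B k = univ) :
    ∃ τ : Measure ((X × Y) × (Y × Z)), τ.map Prod.fst = μ ∧ τ.map Prod.snd = ν ∧
      ∀ᵐ p ∂τ, ∃ k, p.1.2 ∈ B k ∧ p.2.1 ∈ B k := by
  have hm1 : ∀ k, MeasurableSet (Prod.snd ⁻¹' B k : Set (X × Y)) := fun k => measurable_snd (hB k)
  have hm2 : ∀ k, MeasurableSet (Prod.fst ⁻¹' B k : Set (Y × Z)) := fun k => measurable_fst (hB k)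
  have hmass : ∀ k, μ (Prod.snd ⁻¹' B k) = ν (Prod.fst ⁻¹' B k) := fun k => by
    rw [← map_apply measurable_snd (hB k), h, map_apply measurable_fst (hB k)]
  -- In each cell the two measures are coupled independently, after normalisation by their common
  -- mass. On a null cell the factor is `⊤`, but it multiplies the zero measure. No disintegration
  -- is needed.
  refine ⟨Measure.sum fun k => (μ (Prod.snd ⁻¹' B k))⁻¹ •
    (μ.restrict (Prod.snd ⁻¹' B k)).prod (ν.restrict (Prod.fst ⁻¹' B k)), ?_, ?_, ?_⟩
  · rw [Measure.map_sum measurable_fst.aemeasurable]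
    have : ∀ k, ((μ (Prod.snd ⁻¹' B k))⁻¹ • (μ.restrict (Prod.snd ⁻¹' B k)).prod
        (ν.restrict (Prod.fst ⁻¹' B k))).map Prod.fst = μ.restrict (Prod.snd ⁻¹' B k) := by
      intro k
      rw [Measure.map_smul, map_fst_prod, restrict_apply_univ, ← hmass, smul_smul]
      rcases eq_or_ne (μ (Prod.snd ⁻¹' B k)) 0 with h0 | h0
      · rw [restrict_eq_zero.2 h0, smul_zero]
      · rw [ENNReal.inv_mul_cancel h0 (measure_ne_top _ _), one_smul]
    simp_rw [this]
    rw [← restrict_iUnion (fun i j hij => (hd hij).preimage _) hm1, ← preimage_iUnion, hU,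
      preimage_univ, restrict_univ]
  · rw [Measure.map_sum measurable_snd.aemeasurable]
    have : ∀ k, ((μ (Prod.snd ⁻¹' B k))⁻¹ • (μ.restrict (Prod.snd ⁻¹' B k)).prod
        (ν.restrict (Prod.fst ⁻¹' B k))).map Prod.snd = ν.restrict (Prod.fst ⁻¹' B k) := by
      intro k
      rw [Measure.map_smul, map_snd_prod, restrict_apply_univ, smul_smul, hmass]
      rcases eq_or_ne (ν (Prod.fst ⁻¹' B k)) 0 with h0 | h0
      · rw [restrict_eq_zero.2 h0, smul_zero]
      · rw [ENNReal.inv_mul_cancel h0 (measure_ne_top _ _), one_smul]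
    simp_rw [this]
    rw [← restrict_iUnion (fun i j hij => (hd hij).preimage _) hm2, ← preimage_iUnion, hU,
      preimage_univ, restrict_univ]
  · rw [ae_sum_iff]
    intro k
    refine Measure.ae_smul_measure ?_ _
    rw [prod_restrict]
    filter_upwards [ae_restrict_mem ((hm1 k).prod (hm2 k))] with p hp
    exact ⟨k, hp.1, hp.2⟩

end MeasureTheory.Measure

/-- Balls of radius `δ / 2` about a dense sequence, made disjoint. Gluing along these cells makes
the two copies of the shared point `δ`-close. -/
theorem exists_countable_partition_dist_lt (X : Type*) [PseudoMetricSpace X] [Nonempty X]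
    [SecondCountableTopology X] [MeasurableSpace X] [OpensMeasurableSpace X] {δ : ℝ} (hδ : 0 < δ) :
    ∃ B : ℕ → Set X, (∀ k, MeasurableSet (B k)) ∧ Pairwise (Function.onFun Disjoint B) ∧
      ⋃ k, B k = univ ∧ ∀ k, ∀ x ∈ B k, ∀ y ∈ B k, dist x y < δ := by
  refine ⟨disjointed fun k => Metric.ball (TopologicalSpace.denseSeq X k) (δ / 2),
    fun k => MeasurableSet.disjointed (fun _ => measurableSet_ball) k, disjoint_disjointed _, ?_, ?_⟩
  · rw [iUnion_disjointed, eq_univ_iff_forall]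
    intro x
    obtain ⟨k, hk⟩ := (TopologicalSpace.denseRange_denseSeq X).exists_dist_lt x (half_pos hδ)
    exact mem_iUnion.2 ⟨k, hk⟩
  · intro k x hx y hy
    have h1 := disjointed_subset _ k hx
    have h2 := disjointed_subset _ k hy
    rw [Metric.mem_ball] at h1 h2
    calc dist x y ≤ dist x _ + dist y _ := dist_triangle_right _ _ _
      _ < δ := by linarith

section Wasserstein

variable {X : Type*} [MetricSpace X] [MeasurableSpace X] [BorelSpace X]
  [SecondCountableTopology X]

theorem integrable_dist_sq (hX : ∀ x y : X, dist x y ≤ 1) (π : Measure (X × X))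
    [IsFiniteMeasure π] : Integrable (fun p : X × X => dist p.1 p.2 ^ 2) π := by
  refine Integrable.of_bound (measurable_dist.pow_const 2).aestronglyMeasurable 1
    (Eventually.of_forall fun p => ?_)
  rw [Real.norm_eq_abs, abs_of_nonneg (by positivity)]
  exact pow_le_one₀ dist_nonneg (hX _ _)

theorem lintegral_edist_sq (hX : ∀ x y : X, dist x y ≤ 1) (π : Measure (X × X))
    [IsFiniteMeasure π] :
    ∫⁻ p : X × X, edist p.1 p.2 ^ 2 ∂π = ENNReal.ofReal (∫ p : X × X, dist p.1 p.2 ^ 2 ∂π) := by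
  rw [ofReal_integral_eq_lintegral_ofReal (integrable_dist_sq hX π)
    (Eventually.of_forall fun p => by positivity)]
  simp_rw [edist_dist, ENNReal.ofReal_pow dist_nonneg]

omit [BorelSpace X] [SecondCountableTopology X] in
theorem wassersteinDist_sq (μ ν : ProbabilityMeasure X) : wassersteinDist μ ν ^ 2 =
    (⨅ π ∈ transportPlans μ ν,
      ∫⁻ p : X × X, edist p.1 p.2 ^ 2 ∂(π : Measure (X × X))).toReal :=
  Real.sq_sqrt ENNReal.toReal_nonneg

theorem wassersteinDist_sq_le (hX : ∀ x y : X, dist x y ≤ 1) {μ ν : ProbabilityMeasure X}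
    {π : ProbabilityMeasure (X × X)} (hπ : π ∈ transportPlans μ ν) :
    wassersteinDist μ ν ^ 2 ≤ ∫ p : X × X, dist p.1 p.2 ^ 2 ∂(π : Measure (X × X)) := by
  rw [wassersteinDist_sq]
  refine ENNReal.toReal_le_of_le_ofReal (integral_nonneg fun p => by positivity) ?_
  rw [← lintegral_edist_sq hX]
  exact iInf₂_le π hπ

omit [BorelSpace X] in
theorem prod_mem_transportPlans (μ ν : ProbabilityMeasure X) :
    μ.prod ν ∈ transportPlans μ ν := by
  constructor <;> simp [ProbabilityMeasure.toMeasure_prod]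

/-- Near-optimal plans suffice throughout, so the existence of optimal ones is never used. The
product plan shows that the infimum is finite, hence not distorted by `toReal`. -/
theorem exists_transportPlan_lt (hX : ∀ x y : X, dist x y ≤ 1) (μ ν : ProbabilityMeasure X)
    {ε : ℝ} (hε : 0 < ε) : ∃ π ∈ transportPlans μ ν,
      ∫ p : X × X, dist p.1 p.2 ^ 2 ∂(π : Measure (X × X)) < wassersteinDist μ ν ^ 2 + ε := by
  have hfin : (⨅ π ∈ transportPlans μ ν,
      ∫⁻ p : X × X, edist p.1 p.2 ^ 2 ∂(π : Measure (X × X))) ≠ ⊤ := by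
    refine ne_top_of_le_ne_top ?_ (iInf₂_le _ (prod_mem_transportPlans μ ν))
    rw [lintegral_edist_sq hX]
    exact ENNReal.ofReal_ne_top
  have hlt : (⨅ π ∈ transportPlans μ ν, ∫⁻ p : X × X, edist p.1 p.2 ^ 2 ∂(π : Measure (X × X))) <
      ENNReal.ofReal (wassersteinDist μ ν ^ 2 + ε) := by
    rw [ENNReal.lt_ofReal_iff_toReal_lt hfin, ← wassersteinDist_sq]
    linarith
  simp only [iInf_lt_iff] at hlt
  obtain ⟨π, hπ, h⟩ := hlt
  rw [lintegral_edist_sq hX] at h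
  exact ⟨π, hπ, (ENNReal.ofReal_lt_ofReal_iff (by positivity)).1 h⟩

theorem wassersteinDist_sq_le_one (hX : ∀ x y : X, dist x y ≤ 1) (μ ν : ProbabilityMeasure X) :
    wassersteinDist μ ν ^ 2 ≤ 1 := by
  refine (wassersteinDist_sq_le hX (prod_mem_transportPlans μ ν)).trans ?_
  calc _ ≤ ∫ _ : X × X, (1 : ℝ) ∂((μ.prod ν : ProbabilityMeasure (X × X)) : Measure (X × X)) :=
        integral_mono (integrable_dist_sq hX _) (integrable_const _)
          fun p => pow_le_one₀ dist_nonneg (hX _ _)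
    _ = 1 := by simp

/-- A Wasserstein midpoint in a bounded subset of a Hilbert space is approximately coupled with the
midpoints of its end points. -/
theorem exists_coupling_near_midpoint {H : Type*} [NormedAddCommGroup H] [InnerProductSpace ℝ H]
    {ι : X → H} (hι : Isometry ι) (hX : ∀ x y : X, dist x y ≤ 1)
    {μ₀ μ₁ ν : ProbabilityMeasure X}
    (h₀ : wassersteinDist μ₀ ν = wassersteinDist μ₀ μ₁ / 2)
    (h₁ : wassersteinDist ν μ₁ = wassersteinDist μ₀ μ₁ / 2) {ε : ℝ} (hε : 0 < ε) :
    ∃ τ : Measure ((X × X) × (X × X)),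
      τ.map (fun p => p.1.1) = μ₀ ∧ τ.map (fun p => p.1.2) = ν ∧ τ.map (fun p => p.2.2) = μ₁ ∧
      (∀ᵐ p ∂τ, dist p.1.2 p.2.1 < ε) ∧
      ∫ p, ‖ι p.1.1 + ι p.2.2 - ι p.1.2 - ι p.2.1‖ ^ 2 ∂τ ≤ 6 * ε := by
  obtain ⟨π₀, hπ₀, hc₀⟩ := exists_transportPlan_lt hX μ₀ ν hε
  obtain ⟨π₁, hπ₁, hc₁⟩ := exists_transportPlan_lt hX ν μ₁ hε
  have : Nonempty X := μ₀.nonempty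
  obtain ⟨B, hB, hd, hU, hdist⟩ := exists_countable_partition_dist_lt X hε
  obtain ⟨τ, hτ₀, hτ₁, hτB⟩ := Measure.exists_glue_partition (π₀ : Measure (X × X))
    (π₁ : Measure (X × X)) (hπ₀.2.trans hπ₁.1.symm) B hB hd hU
  have hprob : IsProbabilityMeasure τ := by
    constructor
    have := congrArg (fun m => m univ) hτ₀
    simpa [Measure.map_apply measurable_fst] using this
  have hm11 : Measurable fun p : (X × X) × (X × X) => p.1.1 := by fun_prop
  have hm22 : Measurable fun p : (X × X) × (X × X) => p.2.2 := by fun_prop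
  have hl11 : τ.map (fun p => p.1.1) = μ₀ := by
    rw [← hπ₀.1, ← hτ₀, Measure.map_map measurable_fst measurable_fst]; rfl
  have hl12 : τ.map (fun p => p.1.2) = ν := by
    rw [← hπ₀.2, ← hτ₀, Measure.map_map measurable_snd measurable_fst]; rfl
  have hl22 : τ.map (fun p => p.2.2) = μ₁ := by
    rw [← hπ₁.2, ← hτ₁, Measure.map_map measurable_snd measurable_snd]; rfl
  have hnear : ∀ᵐ p ∂τ, dist p.1.2 p.2.1 < ε := by
    filter_upwards [hτB] with p hp
    obtain ⟨k, h1, h2⟩ := hp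
    exact hdist k _ h1 _ h2
  refine ⟨τ, hl11, hl12, hl22, hnear, ?_⟩
  have hi : ∀ f : (X × X) × (X × X) → X × X, Measurable f →
      Integrable (fun p => dist (f p).1 (f p).2 ^ 2) τ := fun f hf =>
    ((integrable_dist_sq hX (τ.map f)).comp_measurable hf)
  have hiA := hi (fun p => p.1) measurable_fst
  have hiB := hi (fun p => p.2) measurable_snd
  have hiC : Integrable (fun p => dist p.1.1 p.2.2 ^ 2) τ :=
    hi (fun p => (p.1.1, p.2.2)) (by fun_prop)
  have hiAB : Integrable (fun p => 2 * dist p.1.1 p.1.2 ^ 2 + 2 * dist p.2.1 p.2.2 ^ 2) τ :=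
    (hiA.const_mul 2).add (hiB.const_mul 2)
  have hiABC : Integrable (fun p => 2 * dist p.1.1 p.1.2 ^ 2 + 2 * dist p.2.1 p.2.2 ^ 2 -
      dist p.1.1 p.2.2 ^ 2) τ := hiAB.sub hiC
  have hA : ∫ p, dist p.1.1 p.1.2 ^ 2 ∂τ = ∫ p : X × X, dist p.1 p.2 ^ 2 ∂(π₀ : Measure _) := by
    rw [← hτ₀, integral_map measurable_fst.aemeasurable
      (measurable_dist.pow_const 2).aestronglyMeasurable]
  have hB' : ∫ p, dist p.2.1 p.2.2 ^ 2 ∂τ = ∫ p : X × X, dist p.1 p.2 ^ 2 ∂(π₁ : Measure _) := by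
    rw [← hτ₁, integral_map measurable_snd.aemeasurable
      (measurable_dist.pow_const 2).aestronglyMeasurable]
  have hmC : Measurable fun p : (X × X) × (X × X) => (p.1.1, p.2.2) := by fun_prop
  have hC : wassersteinDist μ₀ μ₁ ^ 2 ≤ ∫ p, dist p.1.1 p.2.2 ^ 2 ∂τ := by
    have hpr : IsProbabilityMeasure (τ.map fun p => (p.1.1, p.2.2)) :=
      Measure.isProbabilityMeasure_map hmC.aemeasurable
    have := wassersteinDist_sq_le (μ := μ₀) (ν := μ₁) hX (π := ⟨τ.map fun p => (p.1.1, p.2.2), hpr⟩)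
      ⟨by rw [ProbabilityMeasure.coe_mk, Measure.map_map measurable_fst hmC]; exact hl11,
       by rw [ProbabilityMeasure.coe_mk, Measure.map_map measurable_snd hmC]; exact hl22⟩
    rwa [ProbabilityMeasure.coe_mk, integral_map hmC.aemeasurable
      (measurable_dist.pow_const 2).aestronglyMeasurable] at this
  have hbound : ∀ᵐ p ∂τ, ‖ι p.1.1 + ι p.2.2 - ι p.1.2 - ι p.2.1‖ ^ 2 ≤
      2 * dist p.1.1 p.1.2 ^ 2 + 2 * dist p.2.1 p.2.2 ^ 2 - dist p.1.1 p.2.2 ^ 2 + 2 * ε := by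
    filter_upwards [hnear] with p hp
    rw [← hι.dist_eq] at hp
    rw [← hι.dist_eq p.1.1, ← hι.dist_eq p.2.1, ← hι.dist_eq p.1.1]
    have hle := hX p.1.1 p.2.2
    rw [← hι.dist_eq] at hle
    rw [dist_eq_norm] at *
    rw [dist_eq_norm, dist_eq_norm]
    generalize ι p.1.1 = x at *
    generalize ι p.2.2 = y at *
    generalize ι p.1.2 = z at *
    generalize ι p.2.1 = w at *
    -- If `z = w`, the sum of the two vectors is `x - y` and the difference is `x + y - 2z`. In
    -- general `‖z - w‖ < ε` and `‖x - y‖ ≤ 1` cost at most `2ε`.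
    have hpar := parallelogram_law_with_norm ℝ (x - z) (w - y)
    have e1 : x - z - (w - y) = x + y - z - w := by abel
    have e2 : x - z + (w - y) = (x - y) - (z - w) := by abel
    rw [e1, e2] at hpar
    have htri : ‖x - y‖ ^ 2 - 2 * ε ≤ ‖(x - y) - (z - w)‖ ^ 2 := by
      have h1 := norm_sub_norm_le (x - y) (z - w)
      have h2 := norm_nonneg (x - y)
      have h3 := norm_nonneg (x - y - (z - w))
      have h4 := norm_nonneg (z - w)
      rcases le_total ‖x - y‖ ‖z - w‖ with h | h
      · nlinarith
      · nlinarith [mul_self_le_mul_self (sub_nonneg.2 h) h1]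
    nlinarith
  have hrhs : Integrable (fun p => 2 * dist p.1.1 p.1.2 ^ 2 + 2 * dist p.2.1 p.2.2 ^ 2 -
      dist p.1.1 p.2.2 ^ 2 + 2 * ε) τ := hiABC.add (integrable_const _)
  calc _ ≤ ∫ p, (2 * dist p.1.1 p.1.2 ^ 2 + 2 * dist p.2.1 p.2.2 ^ 2 -
      dist p.1.1 p.2.2 ^ 2 + 2 * ε) ∂τ :=
        integral_mono_of_nonneg (Eventually.of_forall fun p => by positivity) hrhs hbound
    _ = 2 * (∫ p, dist p.1.1 p.1.2 ^ 2 ∂τ) + 2 * (∫ p, dist p.2.1 p.2.2 ^ 2 ∂τ) -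
        (∫ p, dist p.1.1 p.2.2 ^ 2 ∂τ) + 2 * ε := by
        rw [integral_add hiABC (integrable_const _), integral_sub hiAB hiC,
          integral_add (hiA.const_mul 2) (hiB.const_mul 2), integral_const_mul, integral_const_mul]
        simp
    -- With `D` the distance of the end measures, the bound is `2(D²/4 + ε) + 2(D²/4 + ε) - D² +
    -- 2ε`.
    _ ≤ 6 * ε := by
        rw [hA, hB']
        rw [h₀] at hc₀
        rw [h₁] at hc₁
        nlinarith

/-- Lower bounds on continuous linear functionals pass to Wasserstein midpoints. -/
theorem ae_le_of_wasserstein_midpoint {H : Type*} [NormedAddCommGroup H] [InnerProductSpace ℝ H]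
    {ι : X → H} (hι : Isometry ι) (hX : ∀ x y : X, dist x y ≤ 1)
    {μ₀ μ₁ ν : ProbabilityMeasure X}
    (h₀ : wassersteinDist μ₀ ν = wassersteinDist μ₀ μ₁ / 2)
    (h₁ : wassersteinDist ν μ₁ = wassersteinDist μ₀ μ₁ / 2) (φ : H →L[ℝ] ℝ) {a b : ℝ}
    (ha : ∀ᵐ x ∂(μ₀ : Measure X), a ≤ φ (ι x)) (hb : ∀ᵐ x ∂(μ₁ : Measure X), b ≤ φ (ι x)) :
    ∀ᵐ z ∂(ν : Measure X), (a + b) / 2 ≤ φ (ι z) := by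
  have hcont : Continuous ι := hι.continuous
  have hφ : Continuous fun x => φ (ι x) := φ.continuous.comp hcont
  obtain ⟨z₀⟩ : Nonempty X := μ₀.nonempty
  -- The squared deficit of the desired inequality. It is zero exactly where the inequality holds,
  -- and its integral does not depend on the coupling, so bounds that tend to `0` with `ε` force it
  -- to vanish almost everywhere.
  set F : X → ℝ := fun z => max (a + b - 2 * φ (ι z)) 0 ^ 2 with hF
  have hFc : Continuous F := by fun_prop
  have hFint : Integrable F (ν : Measure X) := by
    refine Integrable.of_bound hFc.aestronglyMeasurable
      ((|a + b - 2 * φ (ι z₀)| + 2 * ‖φ‖) ^ 2) (Eventually.of_forall fun z => ?_)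
    rw [Real.norm_eq_abs, abs_of_nonneg (by positivity)]
    refine pow_le_pow_left₀ (le_max_right _ _) (max_le ?_ (by positivity)) 2
    have : |φ (ι z₀ - ι z)| ≤ ‖φ‖ * 1 := by
      rw [← Real.norm_eq_abs]
      refine φ.le_opNorm_of_le ?_
      rw [← dist_eq_norm, hι.dist_eq]
      exact hX _ _
    rw [map_sub] at this
    have h1 := (abs_le.1 this).2
    have h2 := le_abs_self (a + b - 2 * φ (ι z₀))
    linarith
  have key : ∀ ε : ℝ, 0 < ε → ∫ z, F z ∂(ν : Measure X) ≤ ‖φ‖ ^ 2 * (12 * ε + 2 * ε ^ 2) := by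
    intro ε hε
    obtain ⟨τ, hl0, hlν, hl1, hnear, hint⟩ := exists_coupling_near_midpoint hι hX h₀ h₁ hε
    have hm11 : Measurable fun p : (X × X) × (X × X) => p.1.1 := by fun_prop
    have hm12 : Measurable fun p : (X × X) × (X × X) => p.1.2 := by fun_prop
    have hm22 : Measurable fun p : (X × X) × (X × X) => p.2.2 := by fun_prop
    have hprob : IsProbabilityMeasure τ := by
      constructor
      have := congrArg (fun m => m univ) hl0
      simpa [Measure.map_apply hm11] using this
    rw [← hlν, integral_map hm12.aemeasurable hFc.aestronglyMeasurable]
    rw [← hl0] at ha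
    rw [← hl1] at hb
    have ha' := ae_of_ae_map hm11.aemeasurable ha
    have hb' := ae_of_ae_map hm22.aemeasurable hb
    have hYc : Continuous fun p : (X × X) × (X × X) =>
      ‖ι p.1.1 + ι p.2.2 - ι p.1.2 - ι p.2.1‖ ^ 2 := by fun_prop
    have hYi : Integrable (fun p : (X × X) × (X × X) =>
        ‖ι p.1.1 + ι p.2.2 - ι p.1.2 - ι p.2.1‖ ^ 2) τ := by
      refine Integrable.of_bound hYc.aestronglyMeasurable (2 ^ 2)
        (Eventually.of_forall fun p => ?_)
      rw [Real.norm_eq_abs, abs_of_nonneg (by positivity)]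
      refine pow_le_pow_left₀ (norm_nonneg _) ?_ 2
      have e : ι p.1.1 + ι p.2.2 - ι p.1.2 - ι p.2.1 =
        (ι p.1.1 - ι p.1.2) + (ι p.2.2 - ι p.2.1) := by abel
      rw [e]
      refine (norm_add_le _ _).trans ?_
      rw [← dist_eq_norm, ← dist_eq_norm, hι.dist_eq, hι.dist_eq]
      linarith [hX p.1.1 p.1.2, hX p.2.2 p.2.1]
    calc ∫ p, F p.1.2 ∂τ
        ≤ ∫ p, ‖φ‖ ^ 2 * (2 * ‖ι p.1.1 + ι p.2.2 - ι p.1.2 - ι p.2.1‖ ^ 2 + 2 * ε ^ 2) ∂τ := by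
          refine integral_mono_of_nonneg (Eventually.of_forall fun p => by positivity)
            (((hYi.const_mul 2).add (integrable_const _)).const_mul _) ?_
          filter_upwards [ha', hb', hnear] with p h1 h2 h3
          set y := ‖ι p.1.1 + ι p.2.2 - ι p.1.2 - ι p.2.1‖ with hy
          have hφ1 : |φ (ι p.1.1 + ι p.2.2 - ι p.1.2 - ι p.2.1)| ≤ ‖φ‖ * y := φ.le_opNorm _
          have hφ2 : |φ (ι p.1.2 - ι p.2.1)| ≤ ‖φ‖ * ε := by
            rw [← Real.norm_eq_abs]
            refine φ.le_opNorm_of_le ?_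
            rw [← dist_eq_norm, hι.dist_eq]
            exact h3.le
          simp only [map_sub, map_add] at hφ1 hφ2
          have hy0 : 0 ≤ y := norm_nonneg _
          -- For end points `x`, `x'` and middle copies `z`, `w`: `a + b - 2φ(z) ≤ φ(x + x' - z - w)
          -- - φ(z - w)`.
          have hmax : max (a + b - 2 * φ (ι p.1.2)) 0 ≤ ‖φ‖ * (y + ε) := by
            refine max_le ?_ (by positivity)
            have := (abs_le.1 hφ1).2
            have := (abs_le.1 hφ2).1
            linarith
          calc F p.1.2 ≤ (‖φ‖ * (y + ε)) ^ 2 := pow_le_pow_left₀ (le_max_right _ _) hmax 2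
            _ = ‖φ‖ ^ 2 * (y + ε) ^ 2 := by ring
            _ ≤ _ := by
              refine mul_le_mul_of_nonneg_left ?_ (by positivity)
              nlinarith [sq_nonneg (y - ε)]
      _ = ‖φ‖ ^ 2 * (2 * (∫ p, ‖ι p.1.1 + ι p.2.2 - ι p.1.2 - ι p.2.1‖ ^ 2 ∂τ) + 2 * ε ^ 2) := by
          rw [integral_const_mul, integral_add (hYi.const_mul 2) (integrable_const _),
            integral_const_mul]
          simp
      _ ≤ _ := by
          refine mul_le_mul_of_nonneg_left ?_ (by positivity)
          linarith
  have hzero : ∫ z, F z ∂(ν : Measure X) = 0 := by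
    refine le_antisymm ?_ (integral_nonneg fun z => by positivity)
    have hlim : Tendsto (fun ε : ℝ => ‖φ‖ ^ 2 * (12 * ε + 2 * ε ^ 2)) (𝓝[>] 0) (𝓝 0) := by
      have : Continuous fun ε : ℝ => ‖φ‖ ^ 2 * (12 * ε + 2 * ε ^ 2) := by fun_prop
      simpa using (this.tendsto 0).mono_left nhdsWithin_le_nhds
    refine ge_of_tendsto hlim ?_
    filter_upwards [self_mem_nhdsWithin] with ε hε using key ε hε
  rw [integral_eq_zero_iff_of_nonneg (fun z => by positivity) hFint] at hzero
  filter_upwards [hzero] with z hz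
  have hz' : max (a + b - 2 * φ (ι z)) 0 = 0 := by
    simpa [hF] using hz
  have := max_eq_right_iff.1 hz'
  linarith

end Wasserstein

/-! ### Coordinates and increments on the simplex. -/

section ExtendEnds

variable {N : ℕ}

@[simp] theorem extendEnds_zero (x : Fin N → ℝ) : extendEnds x 0 = 0 := rfl

@[simp] theorem extendEnds_last (x : Fin N → ℝ) : extendEnds x (Fin.last (N + 1)) = 1 := by
  rw [extendEnds, ← Fin.succ_last, Fin.cons_succ, Fin.snoc_last]

@[simp] theorem extendEnds_castSucc_succ (x : Fin N → ℝ) (i : Fin N) :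
    extendEnds x i.succ.castSucc = x i := by
  rw [extendEnds, ← Fin.succ_castSucc, Fin.cons_succ, Fin.snoc_castSucc]

/-- The increments `x_{i+1} - x_i` of a point of the simplex. -/
noncomputable def increment (i : Fin (N + 1)) (x : Fin N → ℝ) : ℝ :=
  extendEnds x i.succ - extendEnds x i.castSucc

theorem mem_openSimplex {x : Fin N → ℝ} : x ∈ openSimplex N ↔ ∀ i, 0 < increment i x := by
  simp only [openSimplex, mem_ofPred_eq, Fin.strictMono_iff_lt_succ, increment, sub_pos]

theorem measurable_extendEnds (k : Fin (N + 2)) :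
    Measurable fun x : Fin N → ℝ => extendEnds x k := by
  refine Fin.cases ?_ (fun k => ?_) k
  · simp
  · refine Fin.lastCases ?_ (fun k => ?_) k
    · simp
    · simp only [Fin.succ_castSucc, extendEnds_castSucc_succ]
      exact measurable_pi_apply k

theorem measurable_increment (i : Fin (N + 1)) : Measurable (increment (N := N) i) :=
  (measurable_extendEnds _).sub (measurable_extendEnds _)

theorem measurableSet_openSimplex : MeasurableSet (openSimplex N) := by
  have : openSimplex N = ⋂ i, {x | 0 < increment i x} := by
    ext x; simp [mem_openSimplex]
  rw [this]
  exact MeasurableSet.iInter fun i => measurableSet_lt measurable_const (measurable_increment i)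

end ExtendEnds

/-! ### Relative entropy of conditioned and of concentrated measures. -/

section Entropy

variable {X : Type*} [MeasurableSpace X]

theorem relEntropy_self (m : ProbabilityMeasure X) : relEntropy m m = 0 := by
  have h : (fun x => ((m : Measure X).rnDeriv m x).toReal *
      Real.log ((m : Measure X).rnDeriv m x).toReal) =ᵐ[(m : Measure X)] 0 := by
    filter_upwards [Measure.rnDeriv_self (m : Measure X)] with x hx
    simp [hx]
  rw [relEntropy, if_pos ⟨Measure.AbsolutelyContinuous.rfl,
    (integrable_congr h).2 (integrable_zero _ _ _)⟩, integral_congr_ae h]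
  simp

/-- The density is the constant `1 / m(A)` on `A` and zero elsewhere. -/
theorem relEntropy_cond {μ m : ProbabilityMeasure X} {A : Set X} (hA : MeasurableSet A)
    (h0 : (m : Measure X) A ≠ 0) (hμ : (μ : Measure X) = ProbabilityTheory.cond m A) :
    relEntropy μ m = ((-Real.log ((m : Measure X).real A) : ℝ) : EReal) := by
  have hfin : ((m : Measure X) A)⁻¹ ≠ ⊤ := ENNReal.inv_ne_top.2 h0
  have h : (fun x => ((μ : Measure X).rnDeriv m x).toReal *
      Real.log ((μ : Measure X).rnDeriv m x).toReal) =ᵐ[(m : Measure X)]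
      A.indicator fun _ => ((m : Measure X).real A)⁻¹ * Real.log ((m : Measure X).real A)⁻¹ := by
    rw [hμ, ProbabilityTheory.cond]
    filter_upwards [Measure.rnDeriv_smul_left_of_ne_top ((m : Measure X).restrict A) m hfin,
      Measure.rnDeriv_restrict_self (m : Measure X) hA] with x h1 h2
    rw [h1, Pi.smul_apply, h2]
    by_cases hx : x ∈ A <;> simp [hx, Measure.real]
  have hac : (μ : Measure X) ≪ m := by
    rw [hμ]
    exact ProbabilityTheory.cond_absolutelyContinuous
  rw [relEntropy, if_pos ⟨hac, (integrable_congr h).2 ((integrable_const _).indicator hA)⟩,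
    integral_congr_ae h, integral_indicator hA, setIntegral_const, smul_eq_mul, ← mul_assoc,
    mul_inv_cancel₀, one_mul, Real.log_inv]
  exact fun hr => h0 ((measureReal_eq_zero_iff).1 hr)

/-- A measure concentrated on a set of small mass has large entropy. -/
theorem neg_log_le_of_relEntropy_le {μ m : ProbabilityMeasure X} {M : Set X}
    (hM : MeasurableSet M) (hμ : ∀ᵐ x ∂(μ : Measure X), x ∈ M) {q c : ℝ} (hq : 0 < q)
    (hmq : (m : Measure X).real M ≤ q) (hc : relEntropy μ m ≤ (c : EReal)) : -Real.log q ≤ c := by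
  rw [relEntropy] at hc
  split_ifs at hc with h
  swap
  · exact absurd hc (by simp)
  obtain ⟨hac, hint⟩ := h
  rw [EReal.coe_le_coe_iff] at hc
  refine le_trans ?_ hc
  set ρ : X → ℝ := fun x => ((μ : Measure X).rnDeriv m x).toReal with hρ
  have hρint : Integrable ρ (m : Measure X) := Measure.integrable_toReal_rnDeriv
  have hρ1 : ∫ x, ρ x ∂(m : Measure X) = 1 := by
    rw [hρ, Measure.integral_toReal_rnDeriv hac]; simp
  have hout : ∀ᵐ x ∂(m : Measure X), x ∉ M → ρ x = 0 := by
    have hz : ∫⁻ x in Mᶜ, (μ : Measure X).rnDeriv m x ∂(m : Measure X) = 0 :=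
      le_antisymm ((Measure.setLIntegral_rnDeriv_le _).trans (mem_ae_iff.1 hμ).le)
        zero_le
    rw [lintegral_eq_zero_iff (Measure.measurable_rnDeriv _ _)] at hz
    filter_upwards [ae_imp_of_ae_restrict hz] with x hx hxM
    simp [hρ, hx hxM]
  -- Inside `M` this is the tangent line of `t ↦ t log t` at `t = 1/q`; outside `M` both sides
  -- vanish. Integrating it takes the place of Jensen's inequality.
  have hle : ∀ᵐ x ∂(m : Measure X),
      ρ x * (1 - Real.log q) - M.indicator (fun _ => q⁻¹) x ≤ ρ x * Real.log (ρ x) := by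
    filter_upwards [hout] with x hx
    by_cases hxM : x ∈ M
    · rw [indicator_of_mem hxM]
      rcases eq_or_lt_of_le (show 0 ≤ ρ x from ENNReal.toReal_nonneg) with h0 | h0
      · rw [← h0]
        have := inv_pos.2 hq
        linarith
      · have h1 := Real.log_le_sub_one_of_pos (mul_pos hq h0 |> inv_pos.2)
        rw [Real.log_inv, Real.log_mul hq.ne' h0.ne'] at h1
        have h2 := mul_le_mul_of_nonneg_left h1 h0.le
        have h3 : ρ x * ((q * ρ x)⁻¹ - 1) = q⁻¹ - ρ x := by field_simp
        rw [h3] at h2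
        linarith
    · rw [indicator_of_notMem hxM, hx hxM]
      simp
  have hi1 : Integrable (fun x => ρ x * (1 - Real.log q)) (m : Measure X) := hρint.mul_const _
  have hi2 : Integrable (M.indicator fun _ => q⁻¹) (m : Measure X) :=
    (integrable_const _).indicator hM
  calc -Real.log q ≤ 1 * (1 - Real.log q) - (m : Measure X).real M * q⁻¹ := by
        have : (m : Measure X).real M * q⁻¹ ≤ 1 := by
          rw [← div_eq_mul_inv]
          exact div_le_one_of_le₀ hmq hq.le
        linarith
    _ = ∫ x, (ρ x * (1 - Real.log q) - M.indicator (fun _ => q⁻¹) x) ∂(m : Measure X) := by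
        rw [integral_sub hi1 hi2, integral_mul_const, hρ1, integral_indicator hM,
          setIntegral_const, smul_eq_mul]
    _ ≤ _ := integral_mono_ae (hi1.sub hi2) hint hle

end Entropy

/-! ### Monotone functions as a bounded subset of `L²`: averages and evaluations. -/

namespace MonotoneFun

theorem isometry_toL2 : Isometry toL2 := fun _ _ => rfl

instance : SecondCountableTopology MonotoneFun := by
  have : Fact ((2 : ℝ≥0∞) ≠ ⊤) := ⟨by simp⟩
  exact isometry_toL2.isEmbedding.secondCountableTopology

theorem dist_sq_eq (f g : MonotoneFun) : dist f g ^ 2 = ∫ x : I, ((f x : ℝ) - g x) ^ 2 := by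
  rw [← isometry_toL2.dist_eq, dist_eq_norm, ← real_inner_self_eq_norm_sq, L2.inner_def]
  refine integral_congr_ae ?_
  filter_upwards [Lp.coeFn_sub (toL2 f) (toL2 g), f.memLp.coeFn_toLp, g.memLp.coeFn_toLp]
    with x h1 h2 h3
  rw [h1, Pi.sub_apply, toL2, toL2, h2, h3]
  simp [pow_two]

theorem dist_le_one (f g : MonotoneFun) : dist f g ≤ 1 := by
  have : dist f g ^ 2 ≤ 1 := by
    rw [dist_sq_eq]
    have hle : ∀ x : I, ((f x : ℝ) - g x) ^ 2 ≤ 1 := fun x => by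
      have h1 := (f x).2
      have h2 := (g x).2
      rw [sq_le_one_iff_abs_le_one, abs_le]
      constructor <;> linarith [h1.1, h1.2, h2.1, h2.2]
    calc _ ≤ ∫ _ : I, (1 : ℝ) := integral_mono_of_nonneg
          (Eventually.of_forall fun x => by positivity) (integrable_const _)
          (Eventually.of_forall hle)
      _ = 1 := by simp
  nlinarith [dist_nonneg (x := f) (y := g)]

theorem integrable (g : MonotoneFun) : Integrable fun x : I => (g x : ℝ) :=
  g.memLp.integrable (by norm_num)

/-- The average over `(a, b)` as a functional on `L²([0,1])`. -/
noncomputable def averageOn (a b : I) : Lp ℝ 2 (volume : Measure I) →L[ℝ] ℝ :=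
  ((b : ℝ) - a)⁻¹ • innerSL ℝ (indicatorConstLp 2 (measurableSet_Ioo (a := a) (b := b))
    (measure_ne_top _ _) (1 : ℝ))

theorem averageOn_toL2 (a b : I) (g : MonotoneFun) :
    averageOn a b (toL2 g) = ((b : ℝ) - a)⁻¹ * ∫ x in Ioo a b, (g x : ℝ) := by
  simp only [averageOn, smul_apply, innerSL_apply_apply, smul_eq_mul,
    L2.inner_indicatorConstLp_one]
  congr 1
  exact integral_congr_ae (ae_restrict_of_ae g.memLp.coeFn_toLp)

theorem volume_real_Ioo {a b : I} (hab : a < b) :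
    (volume : Measure I).real (Ioo a b) = (b : ℝ) - a := by
  rw [Measure.real, unitInterval.volume_Ioo, ENNReal.toReal_ofReal]
  exact sub_nonneg.2 (Subtype.coe_le_coe.2 hab.le)

theorem le_averageOn {a b : I} (hab : a < b) (g : MonotoneFun) :
    (g a : ℝ) ≤ averageOn a b (toL2 g) := by
  have hpos : (0 : ℝ) < b - a := sub_pos.2 hab
  rw [averageOn_toL2, ← div_eq_inv_mul, le_div_iff₀ hpos]
  calc (g a : ℝ) * (b - a) = ∫ _ in Ioo a b, (g a : ℝ) := by
        rw [setIntegral_const, volume_real_Ioo hab, smul_eq_mul, mul_comm]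
    _ ≤ _ := setIntegral_mono_on (integrable_const _).integrableOn g.integrable.integrableOn
        measurableSet_Ioo fun x hx => g.monotone' hx.1.le

theorem averageOn_le {a b : I} (hab : a < b) (g : MonotoneFun) :
    averageOn a b (toL2 g) ≤ g b := by
  have hpos : (0 : ℝ) < b - a := sub_pos.2 hab
  rw [averageOn_toL2, ← div_eq_inv_mul, div_le_iff₀ hpos]
  calc _ ≤ ∫ _ in Ioo a b, (g b : ℝ) :=
        setIntegral_mono_on g.integrable.integrableOn (integrable_const _).integrableOn
          measurableSet_Ioo fun x hx => g.monotone' hx.2.le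
    _ = _ := by rw [setIntegral_const, volume_real_Ioo hab, smul_eq_mul, mul_comm]

/-- Evaluation is not defined on `L²` classes, but right continuity makes it the limit of averages
over `(t, u n)` with `u n` decreasing to `t`, and these are continuous in `g`. -/
theorem measurable_eval (t : I) : Measurable fun g : MonotoneFun => (g t : ℝ) := by
  rcases eq_or_lt_of_le (show t ≤ 1 from t.2.2) with rfl | ht
  · simp only [map_one']
    exact measurable_const
  · obtain ⟨u, -, hu, hlim⟩ := exists_seq_strictAnti_tendsto' ht
    refine measurable_of_tendsto_metrizable (f := fun n g => averageOn t (u n) (toL2 g))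
      (fun n => ((averageOn t (u n)).continuous.comp isometry_toL2.continuous).measurable) ?_
    rw [tendsto_pi_nhds]
    intro g
    have hg : Tendsto (fun n => (g (u n) : ℝ)) atTop (𝓝 (g t)) := by
      refine (continuous_subtype_val.tendsto _).comp ((g.rightCont' t).tendsto.comp ?_)
      exact tendsto_nhdsWithin_iff.2 ⟨hlim, Eventually.of_forall fun n => (hu n).1.le⟩
    exact tendsto_of_tendsto_of_tendsto_of_le_of_le tendsto_const_nhds hg
      (fun n => le_averageOn (hu n).1 g) fun n => averageOn_le (hu n).1 g

end MonotoneFun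

/-! ### The quadratic estimate forced by a Ricci bound. -/

/-- A generalized Ricci bound controls the mass of `{g s ≥ c}` by that of `{g r ≥ c / 2}`. -/
theorem HasGeneralizedRicciGE.measureReal_le {Q : ProbabilityMeasure MonotoneFun} {K : ℝ}
    (hK : HasGeneralizedRicciGE Q K) {s r : I} (hsr : s < r) {c q : ℝ} (hq : 0 < q)
    (hr : (Q : Measure MonotoneFun).real {g | c / 2 ≤ g r} ≤ q) :
    (Q : Measure MonotoneFun).real {g | c ≤ g s} ≤ q ^ 2 * Real.exp (|K| / 4) := by
  set A : Set MonotoneFun := {g | c ≤ g s} with hA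
  have hAm : MeasurableSet A := measurableSet_le measurable_const (MonotoneFun.measurable_eval s)
  rcases eq_or_ne ((Q : Measure MonotoneFun) A) 0 with h0 | h0
  -- If `A` is null there is nothing to condition on, and the claim is trivial.
  · rw [Measure.real, h0]
    simp only [ENNReal.toReal_zero]
    positivity
  have hp : 0 < (Q : Measure MonotoneFun).real A := ENNReal.toReal_pos h0 (measure_ne_top _ _)
  let μ₀ : ProbabilityMeasure MonotoneFun :=
    ⟨ProbabilityTheory.cond Q A, ProbabilityTheory.cond_isProbabilityMeasure h0⟩
  have hμ₀ : (μ₀ : Measure MonotoneFun) = ProbabilityTheory.cond Q A := rfl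
  obtain ⟨γ, hγ0, hγ1, hgeo, hent⟩ := hK μ₀ Q ProbabilityTheory.cond_absolutelyContinuous
    Measure.AbsolutelyContinuous.rfl
  let h : I := ⟨1 / 2, by norm_num, by norm_num⟩
  have hh : (h : ℝ) = 1 / 2 := rfl
  have hd0 : wassersteinDist μ₀ (γ h) = wassersteinDist μ₀ Q / 2 := by
    have := hgeo 0 h
    rw [hγ0, hγ1, hh] at this
    rw [this]
    norm_num [abs_of_nonneg]
    ring
  have hd1 : wassersteinDist (γ h) Q = wassersteinDist μ₀ Q / 2 := by
    have := hgeo h 1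
    rw [hγ0, hγ1, hh] at this
    rw [this]
    norm_num [abs_of_nonneg]
    ring
  -- Evaluation is not continuous on `L²`, so the bound is carried to the midpoint by the average
  -- over `(s, r)`, which monotonicity places between `g s` and `g r`. This is why `r > s` is
  -- needed.
  have hmid : ∀ᵐ z ∂(γ h : Measure MonotoneFun), z ∈ {g : MonotoneFun | c / 2 ≤ g r} := by
    have h1 : ∀ᵐ x ∂(μ₀ : Measure MonotoneFun),
        c ≤ MonotoneFun.averageOn s r (MonotoneFun.toL2 x) := by
      rw [hμ₀]
      filter_upwards [ProbabilityTheory.ae_cond_mem hAm] with x hx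
      exact le_trans hx (MonotoneFun.le_averageOn hsr x)
    have h2 : ∀ᵐ x ∂(Q : Measure MonotoneFun),
        0 ≤ MonotoneFun.averageOn s r (MonotoneFun.toL2 x) :=
      Eventually.of_forall fun x => (x s).2.1.trans (MonotoneFun.le_averageOn hsr x)
    filter_upwards [ae_le_of_wasserstein_midpoint MonotoneFun.isometry_toL2
      MonotoneFun.dist_le_one hd0 hd1 _ h1 h2] with z hz
    rw [add_zero] at hz
    exact hz.trans (MonotoneFun.averageOn_le hsr z)
  have hEnt := hent h
  rw [relEntropy_self, relEntropy_cond hAm h0 hμ₀, mul_zero, zero_add, ← EReal.coe_mul,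
    ← EReal.coe_sub] at hEnt
  have hfin := neg_log_le_of_relEntropy_le (measurableSet_le measurable_const
    (MonotoneFun.measurable_eval r)) hmid hq hr hEnt
  rw [hh] at hfin
  have hW := wassersteinDist_sq_le_one MonotoneFun.dist_le_one μ₀ Q
  have hKW : -(K / 2 * (1 / 2) * (1 - 1 / 2) * wassersteinDist μ₀ Q ^ 2) ≤ |K| / 8 := by
    have h1 : -K * wassersteinDist μ₀ Q ^ 2 ≤ |K| * 1 :=
      mul_le_mul (neg_le_abs K) hW (sq_nonneg _) (abs_nonneg _)
    linarith
  -- At time `1/2` convexity reads `-log q ≤ -(1/2) log Q(A) + |K|/8`; doubling it produces the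
  -- square and `|K|/4`.
  have hlog : Real.log ((Q : Measure MonotoneFun).real A) ≤
      Real.log (q ^ 2 * Real.exp (|K| / 4)) := by
    rw [Real.log_mul (by positivity) (Real.exp_ne_zero _), Real.log_exp, Real.log_pow]
    push_cast
    linarith
  exact (Real.log_le_log_iff hp (by positivity)).1 hlog

/-! ### Tail estimates for Beta integrals. -/

theorem intervalIntegrable_one_sub_rpow {b c : ℝ} (hb : 0 < b) :
    IntervalIntegrable (fun x : ℝ => (1 - x) ^ (b - 1)) volume c 1 := by
  simpa using ((intervalIntegral.intervalIntegrable_rpow' (a := 1 - c) (b := 0)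
    (r := b - 1) (by linarith)).comp_sub_left 1)

theorem integral_one_sub_rpow {b c : ℝ} (hb : 0 < b) :
    ∫ x in c..1, (1 - x) ^ (b - 1) = (1 - c) ^ b / b := by
  rw [intervalIntegral.integral_comp_sub_left (fun x => x ^ (b - 1)),
    integral_rpow (Or.inl (by linarith))]
  simp [Real.zero_rpow hb.ne']

theorem setIntegral_one_sub_rpow {b c : ℝ} (hb : 0 < b) (hc : c ≤ 1) :
    ∫ x in Ioo c 1, (1 - x) ^ (b - 1) = (1 - c) ^ b / b := by
  rw [← integral_one_sub_rpow hb, intervalIntegral.integral_of_le hc,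
    integral_Ioc_eq_integral_Ioo]

theorem integrableOn_one_sub_rpow {b c : ℝ} (hb : 0 < b) (hc : c ≤ 1) :
    IntegrableOn (fun x : ℝ => (1 - x) ^ (b - 1)) (Ioo c 1) := by
  rw [← integrableOn_Ioc_iff_integrableOn_Ioo]
  exact (intervalIntegrable_iff_integrableOn_Ioc_of_le hc).1 (intervalIntegrable_one_sub_rpow hb)

section BetaTail

variable {a b c : ℝ}

theorem betaTail_le_aux (ha : 0 < a) (hc : 0 < c) {x : ℝ} (hx : x ∈ Ioo (0 : ℝ) 1) :
    (Ici c).indicator 1 x * (x ^ (a - 1) * (1 - x) ^ (b - 1)) ≤ c⁻¹ * (1 - x) ^ (b - 1) := by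
  have h1 : 0 ≤ (1 - x) ^ (b - 1) := Real.rpow_nonneg (by linarith [hx.2]) _
  by_cases hxc : x ∈ Ici c
  · rw [indicator_of_mem hxc, Pi.one_apply, one_mul]
    refine mul_le_mul_of_nonneg_right ?_ h1
    calc x ^ (a - 1) ≤ x ^ (-1 : ℝ) :=
          Real.rpow_le_rpow_of_exponent_ge hx.1 hx.2.le (by linarith)
      _ = x⁻¹ := Real.rpow_neg_one x
      _ ≤ c⁻¹ := inv_anti₀ hc hxc
  · rw [indicator_of_notMem hxc, zero_mul]
    positivity

theorem betaTail_nonneg {x : ℝ} (hx : x ∈ Ioo (0 : ℝ) 1) :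
    0 ≤ (Ici c).indicator 1 x * (x ^ (a - 1) * (1 - x) ^ (b - 1)) := by
  have h1 : 0 ≤ (1 - x) ^ (b - 1) := Real.rpow_nonneg (by linarith [hx.2]) _
  have h2 : 0 ≤ x ^ (a - 1) := Real.rpow_nonneg hx.1.le _
  have h3 : (0 : ℝ) ≤ (Ici c).indicator 1 x := indicator_nonneg (by simp) _
  positivity

/-- On `[c, 1)` one has `x ^ (a - 1) ≤ 1 / x ≤ 1 / c`. The bound is uniform in `a`, which tends to
`0` in the application. -/
theorem betaTail_le (ha : 0 < a) (hb : 0 < b) (hc : 0 < c) :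
    ∫ x in Ioo (0 : ℝ) 1, (Ici c).indicator 1 x * (x ^ (a - 1) * (1 - x) ^ (b - 1)) ≤
      (c * b)⁻¹ := by
  have hI := integrableOn_one_sub_rpow hb zero_le_one
  calc _ ≤ ∫ x in Ioo (0 : ℝ) 1, c⁻¹ * (1 - x) ^ (b - 1) := by
        refine integral_mono_of_nonneg ?_ (hI.const_mul _) ?_
        · filter_upwards [ae_restrict_mem measurableSet_Ioo] with x hx using betaTail_nonneg hx
        · filter_upwards [ae_restrict_mem measurableSet_Ioo] with x hx
            using betaTail_le_aux ha hc hx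
    _ = _ := by
        rw [integral_const_mul, setIntegral_one_sub_rpow hb zero_le_one]
        simp [mul_comm]

/-- For `a < 1` the factor `x ^ (a - 1)` is at least `1` on `(c, 1)`, so again the bound does not
involve `a`. -/
theorem le_betaTail (ha : 0 < a) (ha1 : a < 1) (hb : 0 < b) (hc : 0 < c) (hc1 : c ≤ 1) :
    (1 - c) ^ b / b ≤
      ∫ x in Ioo (0 : ℝ) 1, (Ici c).indicator 1 x * (x ^ (a - 1) * (1 - x) ^ (b - 1)) := by
  have hI := integrableOn_one_sub_rpow hb zero_le_one
  have hint : IntegrableOn (fun x => (Ici c).indicator 1 x * (x ^ (a - 1) * (1 - x) ^ (b - 1)))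
      (Ioo (0 : ℝ) 1) := by
    refine Integrable.mono' (hI.const_mul c⁻¹) ?_ ?_
    · exact ((measurable_one.indicator measurableSet_Ici).mul
        (by fun_prop)).aestronglyMeasurable
    · filter_upwards [ae_restrict_mem measurableSet_Ioo] with x hx
      rw [Real.norm_eq_abs, abs_of_nonneg (betaTail_nonneg hx)]
      exact betaTail_le_aux ha hc hx
  rw [← setIntegral_one_sub_rpow hb hc1]
  calc _ ≤ ∫ x in Ioo c 1, (Ici c).indicator 1 x * (x ^ (a - 1) * (1 - x) ^ (b - 1)) := by
        refine setIntegral_mono_on (integrableOn_one_sub_rpow hb hc1)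
          (hint.mono_set (Ioo_subset_Ioo_left hc.le)) measurableSet_Ioo fun x hx => ?_
        rw [indicator_of_mem (show x ∈ Ici c from hx.1.le), Pi.one_apply, one_mul]
        have h1 : 0 ≤ (1 - x) ^ (b - 1) := Real.rpow_nonneg (by linarith [hx.2]) _
        refine le_mul_of_one_le_left h1 ?_
        exact Real.one_le_rpow_of_pos_of_le_one_of_nonpos (hc.trans hx.1) hx.2.le (by linarith)
    _ ≤ _ := by
        refine setIntegral_mono_set hint ?_ (Ioo_subset_Ioo_left hc.le).eventuallyLE
        filter_upwards [ae_restrict_mem measurableSet_Ioo] with x hx using betaTail_nonneg hx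

end BetaTail

/-! ### The Beta law of a single value, and the contradiction as `s → 0`. -/

theorem IsEntropicMeasure.measureReal_eval {β : ℝ} {Q : ProbabilityMeasure MonotoneFun}
    (hQ : IsEntropicMeasure β Q) {s : I} (h0 : 0 < s) (h1 : s < 1) {B : Set ℝ}
    (hB : MeasurableSet B) :
    (Q : Measure MonotoneFun).real {g | (g s : ℝ) ∈ B} =
      Real.Gamma β / (Real.Gamma (β * s) * Real.Gamma (β * (1 - s))) *
        ∫ x in Ioo (0 : ℝ) 1,
          B.indicator 1 x * (x ^ (β * s - 1) * (1 - x) ^ (β * (1 - s) - 1)) := by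
  have hmono : StrictMono ![0, s, 1] := by
    rw [Fin.strictMono_iff_lt_succ, Fin.forall_fin_two]
    exact ⟨h0, h1⟩
  have key := hQ 1 ![0, s, 1] hmono rfl rfl (fun x => B.indicator 1 (x 0))
    ((measurable_one.indicator hB).comp (measurable_pi_apply 0))
    ⟨1, fun x => by
      by_cases hx : x 0 ∈ B <;> simp [hx]⟩
  have hL : ∫ g : MonotoneFun, B.indicator (1 : ℝ → ℝ) (g s : ℝ) ∂(Q : Measure MonotoneFun) =
      (Q : Measure MonotoneFun).real {g | (g s : ℝ) ∈ B} := by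
    exact integral_indicator_one (MonotoneFun.measurable_eval s hB)
  have e0 : ∀ x : Fin 1 → ℝ, extendEnds x 0 = 0 := fun x => rfl
  have e1 : ∀ x : Fin 1 → ℝ, extendEnds x 1 = x 0 := fun x => extendEnds_castSucc_succ x 0
  have e2 : ∀ x : Fin 1 → ℝ, extendEnds x 2 = 1 := fun x => extendEnds_last x
  have hset : openSimplex 1 = MeasurableEquiv.funUnique (Fin 1) ℝ ⁻¹' Ioo 0 1 := by
    ext x
    rw [mem_openSimplex, Fin.forall_fin_two]
    simp [increment, e0, e1, e2]
  rw [← hL]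
  refine key.trans ?_
  rw [hset, ← (volume_preserving_funUnique (Fin 1) ℝ).setIntegral_preimage_emb
    (MeasurableEquiv.measurableEmbedding _)]
  simp [Fin.prod_univ_two, e0, e1, e2]
  exact Or.inl rfl

/-- The normalising constant of the law of `g s`, divided by `s`. -/
noncomputable def betaCoeff (β s : ℝ) : ℝ :=
  Real.Gamma β * β / (Real.Gamma (β * s + 1) * Real.Gamma (β * (1 - s)))

/-- The pole of `Γ(βs)` at `s = 0`, extracted by `Γ(x + 1) = x Γ(x)`, is what makes the tail
probabilities of order `s`. -/
theorem mul_betaCoeff {β s : ℝ} (hβ : 0 < β) (hs : 0 < s) : s * betaCoeff β s =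
    Real.Gamma β / (Real.Gamma (β * s) * Real.Gamma (β * (1 - s))) := by
  rw [betaCoeff, Real.Gamma_add_one (by positivity)]
  have : Real.Gamma (β * s) ≠ 0 := (Real.Gamma_pos_of_pos (by positivity)).ne'
  field_simp

theorem betaCoeff_pos {β s : ℝ} (hβ : 0 < β) (hs : 0 < s) (hs1 : s < 1) : 0 < betaCoeff β s := by
  have h1 := Real.Gamma_pos_of_pos hβ
  have h2 := Real.Gamma_pos_of_pos (show 0 < β * s + 1 by positivity)
  have h3 := Real.Gamma_pos_of_pos (show 0 < β * (1 - s) from mul_pos hβ (by linarith))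
  rw [betaCoeff]
  positivity

theorem tendsto_betaCoeff {β : ℝ} (hβ : 0 < β) : Tendsto (betaCoeff β) (𝓝 0) (𝓝 β) := by
  have hG : ∀ x : ℝ, 0 < x → ContinuousAt Real.Gamma x := fun x hx =>
    (Real.differentiableAt_Gamma fun m => by
      have : (0 : ℝ) ≤ m := m.cast_nonneg
      linarith).continuousAt
  have hβ0 : Real.Gamma β ≠ 0 := (Real.Gamma_pos_of_pos hβ).ne'
  have h : ContinuousAt (betaCoeff β) 0 := by
    refine ContinuousAt.div continuousAt_const (ContinuousAt.mul ?_ ?_) ?_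
    · exact ContinuousAt.comp' (g := Real.Gamma) (hG _ (by simp)) (by fun_prop)
    · exact ContinuousAt.comp' (g := Real.Gamma) (hG _ (by simpa)) (by fun_prop)
    · simpa
  have hval : betaCoeff β 0 = β := by
    simp [betaCoeff, hβ0]
  simpa [hval] using h.tendsto

theorem IsEntropicMeasure.not_hasGeneralizedRicciGE {β : ℝ} (hβ : 0 < β)
    {Q : ProbabilityMeasure MonotoneFun} (hQ : IsEntropicMeasure β Q) (K : ℝ) :
    ¬ HasGeneralizedRicciGE Q K := by
  intro hK
  -- The quadratic estimate with `c = 3/4` and `r = 2s`, divided by `s`: the left side keeps a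
  -- positive limit, the right side tends to `0`.
  have hev : ∀ᶠ s : ℝ in 𝓝[>] 0, betaCoeff β s * ((1 / 4) ^ β / β) ≤
      s * (2 * betaCoeff β (2 * s) * (16 / (3 * β))) ^ 2 * Real.exp (|K| / 4) := by
    -- `s < 1/4` keeps `1 - 2s` above `1/2`; `s < 1/(2β)` makes the Beta parameter `βs` less than
    -- `1`.
    have hsmall : ∀ᶠ s : ℝ in 𝓝[>] 0, s < min (1 / 4) (1 / (2 * β)) :=
      nhdsWithin_le_nhds (gt_mem_nhds (by positivity))
    filter_upwards [hsmall, self_mem_nhdsWithin] with s hs hs0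
    rw [mem_Ioi] at hs0
    obtain ⟨hs1, hs2⟩ := lt_min_iff.1 hs
    rw [lt_div_iff₀ (by positivity)] at hs2
    have hk1 := betaCoeff_pos hβ hs0 (by linarith)
    have hk2 := betaCoeff_pos hβ (show 0 < 2 * s by linarith) (by linarith)
    let s' : I := ⟨s, by linarith, by linarith⟩
    let r' : I := ⟨2 * s, by linarith, by linarith⟩
    have hs' : 0 < s' := hs0
    have hr' : 0 < r' := show (0 : ℝ) < 2 * s by linarith
    have hs1' : s' < 1 := show s < 1 by linarith
    have hr1' : r' < 1 := show 2 * s < 1 by linarith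
    have hsr : s' < r' := show s < 2 * s by linarith
    have hcs : (s' : ℝ) = s := rfl
    have hcr : (r' : ℝ) = 2 * s := rfl
    -- The tail bound `1 / (c b)` with `c = 3/8` and `b = β(1 - 2s) ≥ β/2` is at most `16 / (3β)`.
    set q := 2 * s * betaCoeff β (2 * s) * (16 / (3 * β)) with hq
    have hq0 : 0 < q := by positivity
    have hup : (Q : Measure MonotoneFun).real {g | (3 / 4 : ℝ) / 2 ≤ g r'} ≤ q := by
      have h := hQ.measureReal_eval hr' hr1' (measurableSet_Ici (a := (3 / 4 : ℝ) / 2))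
      rw [hcr, ← mul_betaCoeff hβ (show 0 < 2 * s by linarith)] at h
      refine h.le.trans (mul_le_mul_of_nonneg_left ?_ (by positivity))
      refine (betaTail_le (mul_pos hβ (by linarith)) (mul_pos hβ (by linarith))
        (by norm_num)).trans ?_
      rw [inv_le_comm₀ (mul_pos (by norm_num) (mul_pos hβ (by linarith))) (by positivity), inv_div]
      nlinarith
    have hlow : s * betaCoeff β s * ((1 / 4) ^ β / β) ≤
        (Q : Measure MonotoneFun).real {g | (3 / 4 : ℝ) ≤ g s'} := by
      have h := hQ.measureReal_eval hs' hs1' (measurableSet_Ici (a := (3 / 4 : ℝ)))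
      rw [hcs, ← mul_betaCoeff hβ hs0] at h
      refine le_trans (mul_le_mul_of_nonneg_left ?_ (by positivity)) h.ge
      have hb : 0 < β * (1 - s) := mul_pos hβ (by linarith)
      refine le_trans ?_ (le_betaTail (mul_pos hβ hs0) (by linarith) hb (by norm_num) (by norm_num))
      have hle : β * (1 - s) ≤ β := by nlinarith
      have : (1 / 4 : ℝ) ^ β ≤ (1 - 3 / 4) ^ (β * (1 - s)) := by
        norm_num only
        exact Real.rpow_le_rpow_of_exponent_ge (by norm_num) (by norm_num) hle
      gcongr
    have hfin := hlow.trans (hK.measureReal_le hsr hq0 hup)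
    have e : q ^ 2 * Real.exp (|K| / 4) = s * (s * (2 * betaCoeff β (2 * s) * (16 / (3 * β))) ^ 2 *
      Real.exp (|K| / 4)) := by
      rw [hq]; ring
    rw [e, mul_assoc] at hfin
    exact le_of_mul_le_mul_left hfin hs0
  have hl1 : Tendsto (fun s : ℝ => betaCoeff β s * ((1 / 4) ^ β / β)) (𝓝[>] 0)
      (𝓝 (β * ((1 / 4) ^ β / β))) :=
    ((tendsto_betaCoeff hβ).mono_left nhdsWithin_le_nhds).mul_const _
  have h2 : Tendsto (fun s : ℝ => 2 * s) (𝓝 0) (𝓝 0) := by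
    simpa using (continuous_const_mul (2 : ℝ)).tendsto 0
  have hl2 : Tendsto (fun s : ℝ => s * (2 * betaCoeff β (2 * s) * (16 / (3 * β))) ^ 2 *
      Real.exp (|K| / 4)) (𝓝[>] 0)
      (𝓝 (0 * (2 * β * (16 / (3 * β))) ^ 2 * Real.exp (|K| / 4))) :=
    ((tendsto_id.mul (((((tendsto_betaCoeff hβ).comp h2).const_mul 2).mul_const _).pow 2)).mul_const
      _).mono_left nhdsWithin_le_nhds
  have hle := le_of_tendsto_of_tendsto hl1 hl2 hev
  rw [zero_mul, zero_mul] at hle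
  have : 0 < β * ((1 / 4 : ℝ) ^ β / β) := by positivity
  linarith

/-! ### The Dirichlet density and its integral. -/

/-- The function `p ↦ p ^ (a - 1)` on the positive half line, extended by zero. -/
noncomputable def posPow (a p : ℝ) : ℝ≥0∞ := if 0 < p then ENNReal.ofReal (p ^ (a - 1)) else 0

theorem posPow_of_pos {p : ℝ} (a : ℝ) (hp : 0 < p) : posPow a p = ENNReal.ofReal (p ^ (a - 1)) :=
  if_pos hp

theorem posPow_of_nonpos {p : ℝ} (a : ℝ) (hp : p ≤ 0) : posPow a p = 0 := if_neg hp.not_gt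

theorem measurable_posPow (a : ℝ) : Measurable (posPow a) :=
  Measurable.ite measurableSet_Ioi (by fun_prop) measurable_const

theorem posPow_mul (a : ℝ) {c : ℝ} (hc : 0 < c) (p : ℝ) :
    posPow a (c * p) = ENNReal.ofReal (c ^ (a - 1)) * posPow a p := by
  rcases le_or_gt p 0 with hp | hp
  · rw [posPow_of_nonpos a hp, posPow_of_nonpos a (mul_nonpos_of_nonneg_of_nonpos hc.le hp),
      mul_zero]
  · rw [posPow_of_pos a hp, posPow_of_pos a (mul_pos hc hp), Real.mul_rpow hc.le hp.le,
      ENNReal.ofReal_mul (by positivity)]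

theorem lintegral_posPow_mul_posPow {a b : ℝ} (ha : 0 < a) (hb : 0 < b) :
    ∫⁻ x, posPow a x * posPow b (1 - x) =
      ENNReal.ofReal (Real.Gamma a * Real.Gamma b / Real.Gamma (a + b)) := by
  have hB := ProbabilityTheory.beta_pos ha hb
  have h : ∀ x, posPow a x * posPow b (1 - x) =
      ENNReal.ofReal (ProbabilityTheory.beta a b) * ProbabilityTheory.betaPDF a b x := by
    intro x
    rw [ProbabilityTheory.betaPDF_eq]
    rcases le_or_gt x 0 with hx | hx
    · rw [posPow_of_nonpos a hx, if_neg fun h => hx.not_gt h.1]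
      simp
    rcases le_or_gt 1 x with hx1 | hx1
    · rw [posPow_of_nonpos b (sub_nonpos.2 hx1), if_neg fun h => hx1.not_gt h.2]
      simp
    rw [posPow_of_pos a hx, posPow_of_pos b (sub_pos.2 hx1), if_pos ⟨hx, hx1⟩,
      ← ENNReal.ofReal_mul (by positivity), ← ENNReal.ofReal_mul hB.le]
    congr 1
    field_simp
  simp_rw [h]
  rw [lintegral_const_mul' _ _ ENNReal.ofReal_ne_top,
    ProbabilityTheory.lintegral_betaPDF_eq_one ha hb, mul_one, ProbabilityTheory.beta]

/-- This is `∫₀ᵖ (p - v)^(a-1) dv = p^a / a`, written so that a factor `p` appears in front of the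
original density; summed over the increments of a point, these factors give `1`. -/
theorem lintegral_posPow_sub {a p : ℝ} (ha : 0 < a) (hp : p ≤ 1) :
    ENNReal.ofReal a * ∫⁻ v in Ioo (0 : ℝ) 1, posPow a (p - v) =
      ENNReal.ofReal p * posPow a p := by
  rcases le_or_gt p 0 with hp0 | hp0
  · rw [posPow_of_nonpos a hp0, setLIntegral_congr_fun measurableSet_Ioo
      (g := fun _ => 0) fun v hv => posPow_of_nonpos a (by linarith [hv.1])]
    simp
  have hsub : ∫⁻ v in Ioo (0 : ℝ) 1, posPow a (p - v) = ∫⁻ v in Ioo (0 : ℝ) p,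
      ENNReal.ofReal ((p - v) ^ (a - 1)) := by
    rw [← lintegral_indicator measurableSet_Ioo, ← lintegral_indicator measurableSet_Ioo]
    congr 1
    ext v
    by_cases hv : v ∈ Ioo (0 : ℝ) p
    · have hv1 : v ∈ Ioo (0 : ℝ) 1 := ⟨hv.1, hv.2.trans_le hp⟩
      rw [indicator_of_mem hv, indicator_of_mem hv1, posPow_of_pos a (sub_pos.2 hv.2)]
    · rw [indicator_of_notMem hv]
      by_cases hv1 : v ∈ Ioo (0 : ℝ) 1
      · rw [indicator_of_mem hv1, posPow_of_nonpos]
        by_contra hlt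
        exact hv ⟨hv1.1, by linarith⟩
      · rw [indicator_of_notMem hv1]
  have hii : IntervalIntegrable (fun v : ℝ => (p - v) ^ (a - 1)) volume 0 p := by
    simpa using ((intervalIntegral.intervalIntegrable_rpow' (a := p) (b := 0)
      (r := a - 1) (by linarith)).comp_sub_left p)
  have hint : IntegrableOn (fun v : ℝ => (p - v) ^ (a - 1)) (Ioo 0 p) := by
    rw [← integrableOn_Ioc_iff_integrableOn_Ioo]
    exact (intervalIntegrable_iff_integrableOn_Ioc_of_le hp0.le).1 hii
  have hval : ∫ v in Ioo 0 p, (p - v) ^ (a - 1) = p ^ a / a := by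
    rw [← integral_Ioc_eq_integral_Ioo, ← intervalIntegral.integral_of_le hp0.le,
      intervalIntegral.integral_comp_sub_left (fun x => x ^ (a - 1)),
      integral_rpow (Or.inl (by linarith))]
    simp [Real.zero_rpow ha.ne']
  rw [hsub, ← ofReal_integral_eq_lintegral_ofReal hint, hval, posPow_of_pos a hp0,
    ← ENNReal.ofReal_mul ha.le, ← ENNReal.ofReal_mul hp0.le, mul_comm p, ← Real.rpow_add_one hp0.ne']
  · congr 1
    field_simp
    simp
  · filter_upwards [ae_restrict_mem measurableSet_Ioo] with v hv
    exact Real.rpow_nonneg (by linarith [hv.2]) _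

theorem lintegral_comp_add_smul {N : ℕ} {c : ℝ} (hc : 0 < c) (e : Fin N → ℝ)
    {G : (Fin N → ℝ) → ℝ≥0∞} (hG : Measurable G) :
    ENNReal.ofReal (c ^ N) * ∫⁻ x, G (e + c • x) = ∫⁻ y, G y := by
  have h1 : ∫⁻ x : Fin N → ℝ, G (e + c • x) =
      ∫⁻ y, G (e + y) ∂((volume : Measure (Fin N → ℝ)).map fun x => c • x) := by
    rw [lintegral_map (by fun_prop) (by fun_prop)]
  rw [h1, Measure.map_addHaar_smul _ hc.ne', lintegral_smul_measure,
    lintegral_add_left_eq_self G e, Module.finrank_fin_fun, abs_of_pos (by positivity), smul_eq_mul,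
    ← mul_assoc, ← ENNReal.ofReal_mul (by positivity), mul_inv_cancel₀ (by positivity),
    ENNReal.ofReal_one, one_mul]

section Increments

variable {N : ℕ}

theorem extendEnds_affine (v : ℝ) (a b : Fin N → ℝ) (k : Fin (N + 2)) :
    extendEnds (v • a + (1 - v) • b) k = v * extendEnds a k + (1 - v) * extendEnds b k := by
  refine Fin.cases ?_ (fun k => ?_) k
  · simp
  · refine Fin.lastCases ?_ (fun k => ?_) k
    · simp
    · simp only [Fin.succ_castSucc, extendEnds_castSucc_succ]
      simp

theorem increment_affine (v : ℝ) (a b : Fin N → ℝ) (k : Fin (N + 1)) :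
    increment k (v • a + (1 - v) • b) = v * increment k a + (1 - v) * increment k b := by
  simp only [increment, extendEnds_affine]
  ring

theorem sum_increment (x : Fin N → ℝ) : ∑ i, increment i x = 1 := by
  have h : ∀ (n : ℕ) (f : Fin (n + 1) → ℝ), ∑ i : Fin n, (f i.succ - f i.castSucc) =
      f (Fin.last n) - f 0 := by
    intro n f
    rw [Finset.sum_sub_distrib]
    have h1 := Fin.sum_univ_succ f
    have h2 := Fin.sum_univ_castSucc f
    linarith
  simpa [increment] using h (N + 1) (extendEnds x)

/-- The vertices of the simplex in the coordinates `(x₁, …, x_N)`. -/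
noncomputable def simplexVertex (i : Fin (N + 1)) : Fin N → ℝ :=
  fun j => if i ≤ j.castSucc then 1 else 0

theorem extendEnds_simplexVertex (i : Fin (N + 1)) (k : Fin (N + 2)) :
    extendEnds (simplexVertex i) k = if i.castSucc < k then 1 else 0 := by
  refine Fin.cases ?_ (fun k => ?_) k
  · simp
  · refine Fin.lastCases ?_ (fun k => ?_) k
    · simp [Fin.castSucc_lt_last]
    · rw [Fin.succ_castSucc, extendEnds_castSucc_succ]
      simp only [simplexVertex, Fin.castSucc_lt_castSucc_iff, Fin.le_castSucc_iff]

/-- The `i`-th vertex carries all the mass in the `i`-th gap, so mixing with it adds mass to that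
increment only. -/
theorem increment_simplexVertex (i k : Fin (N + 1)) :
    increment k (simplexVertex i) = if k = i then 1 else 0 := by
  rw [increment, extendEnds_simplexVertex, extendEnds_simplexVertex]
  simp only [Fin.castSucc_lt_castSucc_iff, ← Fin.le_castSucc_iff, Fin.castSucc_le_castSucc_iff]
  rcases lt_trichotomy i k with h | h | h
  · simp [h, h.le, h.ne']
  · simp [h]
  · simp [h.not_ge, h.not_gt, h.ne]

/-- The unnormalised density of the Dirichlet distribution with parameters `α`. -/
noncomputable def dirichletWeight (α : Fin (N + 1) → ℝ) (x : Fin N → ℝ) : ℝ≥0∞ :=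
  ∏ i, posPow (α i) (increment i x)

theorem measurable_dirichletWeight (α : Fin (N + 1) → ℝ) : Measurable (dirichletWeight α) :=
  Finset.measurable_prod _ fun i _ => (measurable_posPow _).comp (measurable_increment i)

theorem dirichletWeight_eq_zero {α : Fin (N + 1) → ℝ} {x : Fin N → ℝ} {i : Fin (N + 1)}
    (h : increment i x ≤ 0) : dirichletWeight α x = 0 :=
  Finset.prod_eq_zero (Finset.mem_univ i) (posPow_of_nonpos _ h)

theorem extendEnds_cons (a : ℝ) (y : Fin N → ℝ) (k : Fin (N + 2)) :
    extendEnds (Fin.cons a (fun j => a + (1 - a) * y j) : Fin (N + 1) → ℝ) k.succ =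
      a + (1 - a) * extendEnds y k := by
  refine Fin.cases ?_ (fun k => ?_) k
  · rw [extendEnds_zero]
    have := extendEnds_castSucc_succ
      (Fin.cons a (fun j => a + (1 - a) * y j) : Fin (N + 1) → ℝ) 0
    simpa using this
  · refine Fin.lastCases ?_ (fun k => ?_) k
    · simp
    · rw [Fin.succ_castSucc, extendEnds_castSucc_succ, Fin.succ_castSucc, extendEnds_castSucc_succ]
      simp

theorem increment_cons_zero (a : ℝ) (y : Fin N → ℝ) :
    increment 0 (Fin.cons a y : Fin (N + 1) → ℝ) = a := by
  have := extendEnds_castSucc_succ (Fin.cons a y : Fin (N + 1) → ℝ) 0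
  rw [Fin.cons_zero] at this
  rw [increment]
  simpa using this

theorem increment_cons_succ (a : ℝ) (y : Fin N → ℝ) (k : Fin (N + 1)) :
    increment k.succ (Fin.cons a (fun j => a + (1 - a) * y j) : Fin (N + 1) → ℝ) =
      (1 - a) * increment k y := by
  rw [increment, extendEnds_cons, ← Fin.succ_castSucc, extendEnds_cons, increment]
  ring

end Increments

/-- The `N + 1` factors contribute `∑ (α i - 1)` to the exponent and the Jacobian in `N` dimensions
contributes `N`, which leaves `∑ α i - 1`. -/
theorem prod_posPow_mul {N : ℕ} (α : Fin (N + 1) → ℝ) {c : ℝ} (hc : 0 < c)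
    (p : Fin (N + 1) → ℝ) : ENNReal.ofReal (c ^ N) * ∏ i, posPow (α i) (c * p i) =
      ENNReal.ofReal (c ^ (∑ i, α i - 1)) * ∏ i, posPow (α i) (p i) := by
  simp_rw [posPow_mul _ hc, Finset.prod_mul_distrib]
  rw [← ENNReal.ofReal_prod_of_nonneg fun i _ => by positivity, ← mul_assoc,
    ← ENNReal.ofReal_mul (by positivity), ← Real.rpow_sum_of_pos hc, ← Real.rpow_natCast,
    ← Real.rpow_add hc]
  congr 3
  rw [Finset.sum_sub_distrib]
  simp
  ring

/-- The Dirichlet integral. -/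
theorem lintegral_dirichletWeight : ∀ {N : ℕ} (α : Fin (N + 1) → ℝ), (∀ i, 0 < α i) →
    ∫⁻ x, dirichletWeight α x =
      ENNReal.ofReal ((∏ i, Real.Gamma (α i)) / Real.Gamma (∑ i, α i))
  | 0, α, hα => by
    have : ∀ x : Fin 0 → ℝ, dirichletWeight α x = 1 := fun x => by
      have h := sum_increment x
      rw [Fin.sum_univ_one] at h
      rw [dirichletWeight, Fin.prod_univ_one, h, posPow_of_pos _ one_pos]
      simp
    simp_rw [this]
    have h0 := (Real.Gamma_pos_of_pos (hα 0)).ne'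
    simp [h0, volume_pi]
  | N + 1, α, hα => by
    have hm := measurable_dirichletWeight α
    have hA : 0 < ∑ i, Fin.tail α i :=
      Finset.sum_pos (fun i _ => hα _) Finset.univ_nonempty
    rw [← ((volume_preserving_piFinSuccAbove (fun _ : Fin (N + 1) => ℝ) 0).symm).lintegral_comp hm]
    rw [Measure.volume_eq_prod, lintegral_prod _ (by fun_prop)]
    -- Freeze the first coordinate at `a` and rescale the rest from `[a, 1]` to `[0, 1]`: the slice
    -- is a smaller Dirichlet integral, and a Beta integral in `a` remains.
    have key : ∀ a : ℝ, ∫⁻ y : Fin N → ℝ, dirichletWeight α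
        ((MeasurableEquiv.piFinSuccAbove (fun _ : Fin (N + 1) => ℝ) 0).symm (a, y)) =
        posPow (α 0) a * posPow (∑ i, Fin.tail α i) (1 - a) *
          ∫⁻ x, dirichletWeight (Fin.tail α) x := by
      intro a
      have hcons : ∀ y : Fin N → ℝ,
          (MeasurableEquiv.piFinSuccAbove (fun _ : Fin (N + 1) => ℝ) 0).symm (a, y) =
          (Fin.cons a y : Fin (N + 1) → ℝ) := fun y => by
        simp [MeasurableEquiv.piFinSuccAbove, Fin.insertNthEquiv]
      simp_rw [hcons]
      have hmc : Measurable fun y : Fin N → ℝ => dirichletWeight α (Fin.cons a y) := by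
        simp_rw [← hcons]
        exact hm.comp ((MeasurableEquiv.measurable _).comp measurable_prodMk_left)
      have hsplit : ∀ x : Fin (N + 1) → ℝ, dirichletWeight α x =
          posPow (α 0) (increment 0 x) *
            ∏ i : Fin (N + 1), posPow (α i.succ) (increment i.succ x) := fun x =>
        Fin.prod_univ_succ _
      rcases le_or_gt 1 a with ha | ha
      -- The other increments sum to `1 - a ≤ 0`, so one of them is nonpositive and the weight
      -- vanishes.
      · rw [posPow_of_nonpos _ (sub_nonpos.2 ha), mul_zero, zero_mul, lintegral_eq_zero_iff hmc]
        refine Eventually.of_forall fun y => ?_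
        have hs := sum_increment (Fin.cons a y : Fin (N + 1) → ℝ)
        rw [Fin.sum_univ_succ, increment_cons_zero] at hs
        obtain ⟨i, -, hi⟩ : ∃ i ∈ (Finset.univ : Finset (Fin (N + 1))),
            increment i.succ (Fin.cons a y : Fin (N + 1) → ℝ) ≤ 0 := by
          by_contra hne
          push Not at hne
          have := Finset.sum_pos hne Finset.univ_nonempty
          linarith
        exact dirichletWeight_eq_zero hi
      · have hc : 0 < 1 - a := sub_pos.2 ha
        rw [← lintegral_comp_add_smul hc (fun _ => a) hmc]
        have : ∀ y : Fin N → ℝ, dirichletWeight α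
            (Fin.cons a ((fun _ => a) + (1 - a) • y) : Fin (N + 1) → ℝ) =
            posPow (α 0) a * ∏ i, posPow (Fin.tail α i) ((1 - a) * increment i y) := by
          intro y
          have e : (fun _ => a) + (1 - a) • y = fun j => a + (1 - a) * y j := rfl
          rw [hsplit, increment_cons_zero, e]
          simp_rw [increment_cons_succ]
          rfl
        simp_rw [this]
        have hmp : Measurable fun y : Fin N → ℝ =>
            ∏ i, posPow (Fin.tail α i) ((1 - a) * increment i y) :=
          Finset.measurable_prod _ fun i _ =>
            (measurable_posPow _).comp ((measurable_increment i).const_mul _)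
        rw [lintegral_const_mul _ hmp, mul_left_comm, ← lintegral_const_mul _ hmp]
        simp_rw [prod_posPow_mul _ hc]
        rw [lintegral_const_mul' _ _ ENNReal.ofReal_ne_top, posPow_of_pos _ hc, mul_assoc]
        rfl
    simp_rw [key]
    have hmm : Measurable fun x => posPow (α 0) x * posPow (∑ i, Fin.tail α i) (1 - x) :=
      (measurable_posPow _).mul ((measurable_posPow _).comp (measurable_const.sub measurable_id))
    rw [lintegral_mul_const _ hmm, lintegral_posPow_mul_posPow (hα 0) hA,
      lintegral_dirichletWeight (Fin.tail α) fun i => hα _, ← ENNReal.ofReal_mul]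
    · congr 1
      rw [Fin.prod_univ_succ fun i => Real.Gamma (α i), Fin.sum_univ_succ α]
      have h1 : Real.Gamma (∑ i, Fin.tail α i) ≠ 0 := (Real.Gamma_pos_of_pos hA).ne'
      have h2 : ∑ i, Fin.tail α i = ∑ i : Fin (N + 1), α i.succ := rfl
      rw [h2] at h1 ⊢
      have h3 : ∏ i, Real.Gamma (Fin.tail α i) = ∏ i : Fin (N + 1), Real.Gamma (α i.succ) := rfl
      rw [h3]
      field_simp
    · have h1 := Real.Gamma_pos_of_pos hA
      have h2 := Real.Gamma_pos_of_pos (hα 0)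
      have h3 := Real.Gamma_pos_of_pos (add_pos (hα 0) hA)
      positivity

/-! ### Invariance of the Dirichlet density under moving mass to a vertex. -/

section StickBreaking

variable {N : ℕ}

/-- The density of a point at parameter `p` after removing mass `v` from its `i`-th increment. -/
noncomputable def shiftedWeight (α p : Fin (N + 1) → ℝ) (i : Fin (N + 1)) (v : ℝ) : ℝ≥0∞ :=
  ∏ k, posPow (α k) (p k - v * if k = i then 1 else 0)

theorem shiftedWeight_eq (α p : Fin (N + 1) → ℝ) (i : Fin (N + 1)) (v : ℝ) :
    shiftedWeight α p i v =
      posPow (α i) (p i - v) * ∏ k ∈ Finset.univ.erase i, posPow (α k) (p k) := by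
  rw [shiftedWeight, ← Finset.mul_prod_erase Finset.univ _ (Finset.mem_univ i)]
  congr 1
  · simp
  · refine Finset.prod_congr rfl fun k hk => ?_
    simp [Finset.ne_of_mem_erase hk]

theorem measurable_shiftedWeight (α : Fin (N + 1) → ℝ) (i : Fin (N + 1)) :
    Measurable fun q : ℝ × (Fin N → ℝ) =>
      shiftedWeight α (fun k => increment k q.2) i q.1 :=
  Finset.measurable_prod _ fun k _ => (measurable_posPow _).comp
    (((measurable_increment k).comp measurable_snd).sub (measurable_fst.mul_const _))

theorem measurable_shiftedWeight_left (α p : Fin (N + 1) → ℝ) (i : Fin (N + 1)) :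
    Measurable (shiftedWeight α p i) :=
  Finset.measurable_prod _ fun _ _ => (measurable_posPow _).comp
    (measurable_const.sub (measurable_id.mul_const _))

theorem measurable_shiftedWeight_right (α : Fin (N + 1) → ℝ) (i : Fin (N + 1)) (v : ℝ) :
    Measurable fun y : Fin N → ℝ => shiftedWeight α (fun k => increment k y) i v :=
  Finset.measurable_prod _ fun k _ => (measurable_posPow _).comp
    ((measurable_increment k).sub_const _)

/-- The `i`-th term equals `p i` times the full product, and the `p i` sum to `1`. If some `p j ≤
0`, removing mass keeps that entry nonpositive and both sides vanish. -/
theorem sum_lintegral_shiftedWeight {α p : Fin (N + 1) → ℝ} (hα : ∀ i, 0 < α i)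
    (hp : ∑ i, p i = 1) :
    ∑ i, ENNReal.ofReal (α i) * ∫⁻ v in Ioo (0 : ℝ) 1, shiftedWeight α p i v =
      ∏ i, posPow (α i) (p i) := by
  by_cases hpos : ∀ i, 0 < p i
  · have hle : ∀ i, p i ≤ 1 := fun i => by
      rw [← hp]
      exact Finset.single_le_sum (fun k _ => (hpos k).le) (Finset.mem_univ i)
    have : ∀ i, ENNReal.ofReal (α i) * ∫⁻ v in Ioo (0 : ℝ) 1, shiftedWeight α p i v =
        ENNReal.ofReal (p i) * ∏ k, posPow (α k) (p k) := by
      intro i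
      have hm : Measurable fun v => posPow (α i) (p i - v) :=
        (measurable_posPow _).comp (measurable_const.sub measurable_id)
      simp_rw [shiftedWeight_eq]
      rw [lintegral_mul_const _ hm,
        ← mul_assoc, lintegral_posPow_sub (hα i) (hle i), mul_assoc,
        Finset.mul_prod_erase Finset.univ (fun k => posPow (α k) (p k)) (Finset.mem_univ i)]
    simp_rw [this]
    rw [← Finset.sum_mul, ← ENNReal.ofReal_sum_of_nonneg fun i _ => (hpos i).le, hp]
    simp
  · push Not at hpos
    obtain ⟨j, hj⟩ := hpos
    rw [Finset.prod_eq_zero (Finset.mem_univ j) (posPow_of_nonpos _ hj)]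
    refine Finset.sum_eq_zero fun i _ => ?_
    rw [setLIntegral_congr_fun measurableSet_Ioo (g := fun _ => 0) fun v hv => ?_]
    · simp
    · refine Finset.prod_eq_zero (Finset.mem_univ j) (posPow_of_nonpos _ ?_)
      have : 0 ≤ v * if j = i then 1 else 0 := mul_nonneg hv.1.le (by split_ifs <;> simp)
      linarith

/-- Substitute `y = v e + (1 - v) x` with `e` the `i`-th vertex. Removing `v` from the `i`-th
increment of `y` leaves `1 - v` times the increments of `x`, and the homogeneity of the weight
yields the power of `1 - v`. -/
theorem lintegral_stick_eq_lintegral_shiftedWeight (α : Fin (N + 1) → ℝ) (i : Fin (N + 1))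
    {F : (Fin N → ℝ) → ℝ≥0∞} (hF : Measurable F) {v : ℝ} (hv : v ∈ Ioo (0 : ℝ) 1) :
    ENNReal.ofReal ((1 - v) ^ (∑ i, α i - 1)) *
        ∫⁻ x, F (v • simplexVertex i + (1 - v) • x) * dirichletWeight α x =
      ∫⁻ y, F y * shiftedWeight α (fun k => increment k y) i v := by
  have hc : 0 < 1 - v := sub_pos.2 hv.2
  have hm : Measurable fun y => F y * shiftedWeight α (fun k => increment k y) i v :=
    hF.mul (measurable_shiftedWeight_right α i v)
  rw [← lintegral_comp_add_smul hc (v • simplexVertex i) hm,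
    ← lintegral_const_mul' _ _ ENNReal.ofReal_ne_top,
    ← lintegral_const_mul' _ _ ENNReal.ofReal_ne_top]
  refine lintegral_congr fun x => ?_
  have : shiftedWeight α (fun k => increment k (v • simplexVertex i + (1 - v) • x)) i v =
      ∏ k, posPow (α k) ((1 - v) * increment k x) := by
    refine Finset.prod_congr rfl fun k _ => ?_
    simp only [increment_affine, increment_simplexVertex, add_sub_cancel_left]
  rw [this, mul_left_comm (ENNReal.ofReal ((1 - v) ^ N)), prod_posPow_mul α hc, mul_left_comm,
    dirichletWeight]

/-- The Dirichlet weight is reproduced by moving a `Beta(1, ∑ α)`-proportion of the mass to a random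
vertex of the simplex. -/
theorem lintegral_dirichletWeight_stick {α : Fin (N + 1) → ℝ} (hα : ∀ i, 0 < α i)
    {F : (Fin N → ℝ) → ℝ≥0∞} (hF : Measurable F) :
    ∑ i, ∫⁻ v in Ioo (0 : ℝ) 1, ENNReal.ofReal (α i) *
        (ENNReal.ofReal ((1 - v) ^ (∑ i, α i - 1)) *
          ∫⁻ x, F (v • simplexVertex i + (1 - v) • x) * dirichletWeight α x) =
      ∫⁻ x, F x * dirichletWeight α x := by
  have h1 : ∀ i, ∫⁻ v in Ioo (0 : ℝ) 1, ENNReal.ofReal (α i) *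
        (ENNReal.ofReal ((1 - v) ^ (∑ i, α i - 1)) *
          ∫⁻ x, F (v • simplexVertex i + (1 - v) • x) * dirichletWeight α x) =
      ∫⁻ y, F y * (ENNReal.ofReal (α i) *
        ∫⁻ v in Ioo (0 : ℝ) 1, shiftedWeight α (fun k => increment k y) i v) := by
    intro i
    have hm := measurable_shiftedWeight α i
    rw [setLIntegral_congr_fun measurableSet_Ioo fun v hv => by
      rw [lintegral_stick_eq_lintegral_shiftedWeight α i hF hv],
      lintegral_const_mul' _ _ ENNReal.ofReal_ne_top, lintegral_lintegral_swap
        (((hF.comp measurable_snd).mul hm).aemeasurable),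
      ← lintegral_const_mul' _ _ ENNReal.ofReal_ne_top]
    refine lintegral_congr fun y => ?_
    rw [lintegral_const_mul _ (measurable_shiftedWeight_left _ _ _), mul_left_comm]
  simp_rw [h1]
  rw [← lintegral_finsetSum]
  · refine lintegral_congr fun y => ?_
    rw [← Finset.mul_sum, sum_lintegral_shiftedWeight hα (sum_increment y)]
    rfl
  · intro i _
    exact hF.mul (((measurable_shiftedWeight α i).lintegral_prod_left').const_mul _)

end StickBreaking

/-! ### The law of one stick-breaking step. -/

/-- The joint law of a stick proportion, distributed as `Beta(1, β)`, and a uniform location. -/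
noncomputable def stickLaw (β : ℝ) : Measure (I × I) :=
  (((volume.restrict (Ioo (0 : ℝ) 1)).withDensity
    fun v => ENNReal.ofReal (β * (1 - v) ^ (β - 1))).map (projIcc 0 1 zero_le_one)).prod volume

theorem lintegral_stickLaw (β : ℝ) {H : ℝ → I → ℝ≥0∞} (hH : Measurable (Function.uncurry H)) :
    ∫⁻ s : I × I, H s.1 s.2 ∂stickLaw β =
      ∫⁻ v in Ioo (0 : ℝ) 1, ENNReal.ofReal (β * (1 - v) ^ (β - 1)) * ∫⁻ u, H v u := by
  have hp : Measurable (projIcc (0 : ℝ) 1 zero_le_one) := continuous_projIcc.measurable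
  have hm : Measurable fun s : I × I => H s.1 s.2 :=
    hH.comp ((measurable_subtype_coe.comp measurable_fst).prodMk measurable_snd)
  have hm2 : Measurable fun v : ℝ => ∫⁻ u, H (projIcc (0 : ℝ) 1 zero_le_one v) u :=
    hH.lintegral_prod_right'.comp (measurable_subtype_coe.comp hp)
  rw [stickLaw, lintegral_prod _ hm.aemeasurable, lintegral_map hm.lintegral_prod_right' hp,
    lintegral_withDensity_eq_lintegral_mul _ (by fun_prop) hm2]
  refine setLIntegral_congr_fun measurableSet_Ioo fun v hv => ?_
  simp only [Pi.mul_apply]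
  rw [projIcc_of_mem zero_le_one (Ioo_subset_Icc_self hv)]

theorem lintegral_const_mul_one_sub_rpow {β : ℝ} (hβ : 0 < β) :
    ∫⁻ v in Ioo (0 : ℝ) 1, ENNReal.ofReal (β * (1 - v) ^ (β - 1)) = 1 := by
  rw [← ofReal_integral_eq_lintegral_ofReal
    ((integrableOn_one_sub_rpow hβ zero_le_one).const_mul β), integral_const_mul,
    setIntegral_one_sub_rpow hβ zero_le_one]
  · simp [hβ.ne']
  · filter_upwards [ae_restrict_mem measurableSet_Ioo] with v hv
    exact mul_nonneg hβ.le (Real.rpow_nonneg (by linarith [hv.2]) _)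

theorem isProbabilityMeasure_stickLaw {β : ℝ} (hβ : 0 < β) :
    IsProbabilityMeasure (stickLaw β) := by
  constructor
  have := lintegral_stickLaw β (H := fun _ _ => 1) measurable_const
  simpa [lintegral_const_mul_one_sub_rpow hβ] using this

/-- The proportion is positive almost surely. This mean is the contraction rate of the
stick-breaking step. -/
theorem integral_stickLaw_lt_one {β : ℝ} (hβ : 0 < β) :
    ∫ s : I × I, (1 - (s.1 : ℝ)) ∂stickLaw β < 1 := by
  have hprob := isProbabilityMeasure_stickLaw hβ
  have hm : Measurable fun s : I × I => (s.1 : ℝ) := by fun_prop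
  have hint : Integrable (fun s : I × I => (s.1 : ℝ)) (stickLaw β) :=
    Integrable.of_bound hm.aestronglyMeasurable 1
      (Eventually.of_forall fun s => by
        rw [Real.norm_eq_abs, abs_of_nonneg s.1.2.1]
        exact s.1.2.2)
  rw [integral_sub (integrable_const _) hint]
  have hpos : 0 < ∫ s : I × I, (s.1 : ℝ) ∂stickLaw β := by
    refine lt_of_le_of_ne (integral_nonneg fun s => s.1.2.1) fun h0 => ?_
    have hz := (integral_eq_zero_iff_of_nonneg (fun s : I × I => s.1.2.1) hint).1 h0.symm
    have h1 : ∫⁻ s : I × I, ENNReal.ofReal (s.1 : ℝ) ∂stickLaw β = 0 := by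
      rw [lintegral_eq_zero_iff (by fun_prop)]
      filter_upwards [hz] with s hs
      simp only [Pi.zero_apply] at hs ⊢
      rw [hs, ENNReal.ofReal_zero]
    rw [lintegral_stickLaw β (H := fun v _ => ENNReal.ofReal v)
      (ENNReal.measurable_ofReal.comp measurable_fst)] at h1
    have h2 : Measurable fun v : ℝ => ENNReal.ofReal (β * (1 - v) ^ (β - 1)) *
        ∫⁻ _ : I, ENNReal.ofReal v := by
      simp only [lintegral_const, measure_univ, mul_one]
      fun_prop
    rw [lintegral_eq_zero_iff h2, EventuallyEq, ae_restrict_iff' measurableSet_Ioo] at h1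
    have h3 : volume (Ioo (0 : ℝ) 1) = 0 := by
      refine measure_mono_null (fun v hv => ?_) h1
      simp only [mem_compl_iff, mem_ofPred_eq, not_forall]
      refine ⟨hv, ?_⟩
      simp only [lintegral_const, measure_univ, mul_one, Pi.zero_apply, mul_eq_zero,
        ENNReal.ofReal_eq_zero, not_or, not_le]
      exact ⟨mul_pos hβ (Real.rpow_pos_of_pos (by linarith [hv.2]) _), hv.1⟩
    simp at h3
  rw [integral_const, probReal_univ, one_smul]
  linarith

/-! ### The random distribution function and its recursion. -/

section StickProcess

/-- The weights `v_k ∏_{j < k} (1 - v_j)` obtained by breaking a stick of unit length. -/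
noncomputable def stickWeight (ω : ℕ → I × I) (k : ℕ) : ℝ :=
  (ω k).1 * ∏ j ∈ Finset.range k, (1 - ((ω j).1 : ℝ))

theorem one_sub_coe_nonneg (x : I) : 0 ≤ 1 - (x : ℝ) := sub_nonneg.2 x.2.2

theorem stickWeight_nonneg (ω : ℕ → I × I) (k : ℕ) : 0 ≤ stickWeight ω k :=
  mul_nonneg (ω k).1.2.1 (Finset.prod_nonneg fun _ _ => one_sub_coe_nonneg _)

theorem sum_stickWeight (ω : ℕ → I × I) (n : ℕ) : ∑ k ∈ Finset.range n, stickWeight ω k =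
    1 - ∏ j ∈ Finset.range n, (1 - ((ω j).1 : ℝ)) := by
  induction n with
  | zero => simp
  | succ n ih =>
    rw [Finset.sum_range_succ, ih, Finset.prod_range_succ, stickWeight]
    ring

theorem sum_stickWeight_le_one (ω : ℕ → I × I) (n : ℕ) :
    ∑ k ∈ Finset.range n, stickWeight ω k ≤ 1 := by
  rw [sum_stickWeight]
  linarith [Finset.prod_nonneg fun j (_ : j ∈ Finset.range n) => one_sub_coe_nonneg (ω j).1]

theorem summable_stickWeight (ω : ℕ → I × I) : Summable (stickWeight ω) :=
  summable_of_sum_range_le (stickWeight_nonneg ω) (sum_stickWeight_le_one ω)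

/-- The mass to the right of `t` of the discrete measure with weights `stickWeight ω k`. -/
noncomputable def stickTail (ω : ℕ → I × I) (t : I) : ℝ :=
  ∑' k, stickWeight ω k * if t < (ω k).2 then 1 else 0

theorem stickTail_term_nonneg (ω : ℕ → I × I) (t : I) (k : ℕ) :
    0 ≤ stickWeight ω k * if t < (ω k).2 then 1 else 0 :=
  mul_nonneg (stickWeight_nonneg ω k) (by split_ifs <;> simp)

theorem stickTail_term_le (ω : ℕ → I × I) (t : I) (k : ℕ) :
    (stickWeight ω k * if t < (ω k).2 then 1 else 0) ≤ stickWeight ω k :=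
  mul_le_of_le_one_right (stickWeight_nonneg ω k) (by split_ifs <;> simp)

theorem summable_stickTail (ω : ℕ → I × I) (t : I) :
    Summable fun k => stickWeight ω k * if t < (ω k).2 then 1 else 0 :=
  (summable_stickWeight ω).of_nonneg_of_le (stickTail_term_nonneg ω t) (stickTail_term_le ω t)

theorem stickTail_nonneg (ω : ℕ → I × I) (t : I) : 0 ≤ stickTail ω t :=
  tsum_nonneg (stickTail_term_nonneg ω t)

theorem stickTail_le_one (ω : ℕ → I × I) (t : I) : stickTail ω t ≤ 1 :=
  ((summable_stickTail ω t).tsum_le_tsum (stickTail_term_le ω t) (summable_stickWeight ω)).trans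
    ((summable_stickWeight ω).tsum_le_of_sum_range_le (sum_stickWeight_le_one ω))

theorem stickTail_antitone (ω : ℕ → I × I) : Antitone (stickTail ω) := by
  intro s t hst
  refine (summable_stickTail ω t).tsum_le_tsum (fun k => ?_) (summable_stickTail ω s)
  refine mul_le_mul_of_nonneg_left ?_ (stickWeight_nonneg ω k)
  by_cases h : t < (ω k).2
  · simp [h, hst.trans_lt h]
  · rw [if_neg h]
    split_ifs <;> simp

theorem stickTail_one (ω : ℕ → I × I) : stickTail ω 1 = 0 := by
  have : ∀ k, ¬ (1 : I) < (ω k).2 := fun k => not_lt.2 (ω k).2.2.2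
  simp [stickTail, this]

/-- Because the inequality `t < (ω k).2` is strict, each term is constant just to the right of `t`;
the summable weights dominate. -/
theorem stickTail_rightCont (ω : ℕ → I × I) (t : I) :
    ContinuousWithinAt (stickTail ω) (Ici t) t := by
  refine tendsto_tsum_of_dominated_convergence (summable_stickWeight ω) (fun k => ?_)
    (Eventually.of_forall fun s k => ?_)
  · refine (tendsto_const_nhds (x := stickWeight ω k * if t < (ω k).2 then 1 else 0)).congr' ?_
    by_cases h : t < (ω k).2
    · filter_upwards [nhdsWithin_le_nhds (gt_mem_nhds h)] with s hs
      rw [if_pos h, if_pos hs]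
    · filter_upwards [self_mem_nhdsWithin] with s hs
      rw [if_neg h, if_neg fun h' => h (lt_of_le_of_lt hs h')]
  · rw [Real.norm_eq_abs, abs_of_nonneg (stickTail_term_nonneg ω s k)]
    exact stickTail_term_le ω s k

/-- The distribution function of the stick-breaking measure; mass lost in the limit sits at `0`. -/
noncomputable def stickFun (ω : ℕ → I × I) : MonotoneFun where
  toFun t := ⟨1 - stickTail ω t, by linarith [stickTail_le_one ω t],
    by linarith [stickTail_nonneg ω t]⟩
  monotone' s t hst := Subtype.coe_le_coe.1 (sub_le_sub_left (stickTail_antitone ω hst) 1)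
  rightCont' t := by
    rw [ContinuousWithinAt, tendsto_subtype_rng]
    exact (stickTail_rightCont ω t).const_sub 1
  map_one' := Subtype.ext (by simp [stickTail_one])

theorem stickFun_apply (ω : ℕ → I × I) (t : I) : (stickFun ω t : ℝ) = 1 - stickTail ω t := rfl

theorem measurable_stickTail :
    Measurable fun q : (ℕ → I × I) × I => stickTail q.1 q.2 := by
  have hc : ∀ k, Measurable fun q : (ℕ → I × I) × I => q.1 k := fun k =>
    (measurable_pi_apply k).comp measurable_fst
  have hterm : ∀ k, Measurable fun q : (ℕ → I × I) × I =>
      stickWeight q.1 k * if q.2 < (q.1 k).2 then 1 else 0 := by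
    intro k
    refine Measurable.mul ?_ (Measurable.ite ?_ measurable_const measurable_const)
    · refine Measurable.mul (measurable_subtype_coe.comp (hc k).fst) ?_
      exact Finset.measurable_prod _ fun j _ =>
        measurable_const.sub (measurable_subtype_coe.comp (hc j).fst)
    · exact measurableSet_lt measurable_snd (hc k).snd
  refine measurable_of_tendsto_metrizable (f := fun n q => ∑ k ∈ Finset.range n,
    (stickWeight q.1 k * if q.2 < (q.1 k).2 then 1 else 0))
    (fun n => Finset.measurable_sum _ fun k _ => hterm k) ?_
  rw [tendsto_pi_nhds]
  exact fun q => (summable_stickTail q.1 q.2).hasSum.tendsto_sum_nat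

/-- By second countability every open set is a countable union of balls, whose preimages are
sublevel sets of distances. -/
theorem measurable_of_measurable_dist {Ω X : Type*} [MeasurableSpace Ω] [PseudoMetricSpace X]
    [SecondCountableTopology X] [MeasurableSpace X] [BorelSpace X] {f : Ω → X}
    (h : ∀ x, Measurable fun ω => dist (f ω) x) : Measurable f := by
  refine measurable_of_isOpen fun U hU => ?_
  choose! r hr hrU using Metric.isOpen_iff.1 hU
  obtain ⟨T, hT, hTU⟩ := TopologicalSpace.isOpen_iUnion_countable
    (fun x : U => Metric.ball (x : X) (r x)) fun x => Metric.isOpen_ball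
  have hUeq : U = ⋃ x ∈ T, Metric.ball (x : X) (r x) := by
    rw [hTU]
    refine Subset.antisymm (fun x hx => ?_) (iUnion_subset fun x => hrU x x.2)
    exact mem_iUnion.2 ⟨⟨x, hx⟩, Metric.mem_ball_self (hr x hx)⟩
  rw [hUeq, preimage_iUnion₂]
  exact MeasurableSet.biUnion hT fun x _ => measurableSet_lt (h x) measurable_const

theorem measurable_stickFun : Measurable stickFun := by
  refine measurable_of_measurable_dist fun g => ?_
  have h : Measurable fun q : (ℕ → I × I) × I => ((stickFun q.1 q.2 : ℝ) - g q.2) ^ 2 := by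
    refine ((measurable_const.sub measurable_stickTail).sub ?_).pow_const 2
    exact (measurable_subtype_coe.comp g.monotone'.measurable).comp measurable_snd
  have h2 : Measurable fun ω => ∫ x : I, ((stickFun ω x : ℝ) - g x) ^ 2 :=
    (h.stronglyMeasurable.integral_prod_right').measurable
  have : (fun ω => dist (stickFun ω) g) = fun ω => √(∫ x : I, ((stickFun ω x : ℝ) - g x) ^ 2) := by
    ext ω
    rw [← MonotoneFun.dist_sq_eq, Real.sqrt_sq dist_nonneg]
  rw [this]
  exact h2.sqrt

/-- Prepend a term to a sequence. -/
def consSeq {S : Type*} (s : S) (ω : ℕ → S) : ℕ → S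
  | 0 => s
  | n + 1 => ω n

theorem measurable_consSeq {S : Type*} [MeasurableSpace S] :
    Measurable fun q : S × (ℕ → S) => consSeq q.1 q.2 := by
  refine measurable_pi_lambda _ fun n => ?_
  cases n with
  | zero => exact measurable_fst
  | succ n => exact (measurable_pi_apply n).comp measurable_snd

/-- An independent first term prepended to an i.i.d. sequence gives the same i.i.d. law; this turns
the pathwise recursion below into stationarity. -/
theorem map_consSeq_infinitePi {S : Type*} [MeasurableSpace S] (μ : Measure S)
    [IsProbabilityMeasure μ] :
    (μ.prod (Measure.infinitePi fun _ : ℕ => μ)).map (fun q => consSeq q.1 q.2) =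
      Measure.infinitePi fun _ : ℕ => μ := by
  classical
  refine Measure.eq_infinitePi _ fun s t ht => ?_
  obtain ⟨n, hn⟩ := s.exists_nat_subset_range
  have hsub : s ⊆ Finset.range (n + 1) := hn.trans (Finset.range_subset_range.2 n.le_succ)
  -- Padding with `univ` turns the cylinder into one over an initial segment, where the coordinate
  -- `0` splits off.
  set t' : ℕ → Set S := fun i => if i ∈ s then t i else univ with ht'
  have htm : ∀ i, MeasurableSet (t' i) := fun i => by
    simp only [ht']
    split_ifs
    · exact ht i
    · exact MeasurableSet.univ
  have hpre : (fun q : S × (ℕ → S) => consSeq q.1 q.2) ⁻¹' Set.pi s t =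
      t' 0 ×ˢ Set.pi (Finset.range n) fun i => t' (i + 1) := by
    ext q
    simp only [mem_preimage, Set.mem_pi, mem_prod, Finset.mem_coe, Finset.mem_range, ht']
    constructor
    · intro h
      refine ⟨?_, fun i _ => ?_⟩
      · split_ifs with h0
        · exact h 0 h0
        · trivial
      · split_ifs with h0
        · exact h (i + 1) h0
        · trivial
    · rintro ⟨h0, h1⟩ i hi
      cases i with
      | zero => simpa [hi, consSeq] using h0
      | succ i =>
        have := h1 i (by simpa using hsub hi)
        simpa [hi, consSeq] using this
  rw [Measure.map_apply measurable_consSeq (MeasurableSet.pi s.countable_toSet fun i _ => ht i),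
    hpre, Measure.prod_prod, Measure.infinitePi_pi _ fun i _ => htm _]
  have : ∏ i ∈ s, μ (t i) = ∏ i ∈ Finset.range (n + 1), μ (t' i) := by
    rw [← Finset.prod_subset hsub fun i _ hi => by simp [ht', hi]]
    exact Finset.prod_congr rfl fun i hi => by simp [ht', hi]
  rw [this, Finset.prod_range_succ', mul_comm]

theorem stickWeight_consSeq_succ (s : I × I) (ω : ℕ → I × I) (k : ℕ) :
    stickWeight (consSeq s ω) (k + 1) = (1 - (s.1 : ℝ)) * stickWeight ω k := by
  rw [stickWeight, stickWeight, Finset.prod_range_succ']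
  simp only [consSeq]
  ring

/-- After the first break the remainder is a stick of length `1 - s.1` broken by the shifted
sequence. The identity holds for every sequence, so it need not be known that the weights sum to
`1`. -/
theorem stickFun_consSeq (s : I × I) (ω : ℕ → I × I) (t : I) :
    (stickFun (consSeq s ω) t : ℝ) =
      s.1 * (if s.2 ≤ t then 1 else 0) + (1 - (s.1 : ℝ)) * stickFun ω t := by
  have h : stickTail (consSeq s ω) t =
      s.1 * (if t < s.2 then 1 else 0) + (1 - (s.1 : ℝ)) * stickTail ω t := by
    rw [stickTail, (summable_stickTail _ t).tsum_eq_zero_add, stickTail, ← tsum_mul_left]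
    congr 1
    · simp only [stickWeight, consSeq, Finset.range_zero, Finset.prod_empty, mul_one]
      rfl
    · refine tsum_congr fun k => ?_
      rw [stickWeight_consSeq_succ, mul_assoc]
      rfl
  rw [stickFun_apply, stickFun_apply, h]
  by_cases hs : s.2 ≤ t
  · rw [if_pos hs, if_neg hs.not_gt]
    ring
  · rw [if_neg hs, if_pos (not_le.1 hs)]
    ring

end StickProcess

/-! ### Uniqueness of the stationary law by contraction. -/

section Uniqueness

variable {N : ℕ}

/-- Move the proportion `s.1` of the mass of `x` to the point `e s.2`. -/
noncomputable def stickMap (e : I → Fin N → ℝ) (q : (I × I) × (Fin N → ℝ)) : Fin N → ℝ :=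
  (q.1.1 : ℝ) • e q.1.2 + (1 - (q.1.1 : ℝ)) • q.2

theorem measurable_stickMap {e : I → Fin N → ℝ} (he : Measurable e) : Measurable (stickMap e) := by
  have h1 : Measurable fun q : (I × I) × (Fin N → ℝ) => e q.1.2 :=
    he.comp (measurable_snd.comp measurable_fst)
  unfold stickMap
  fun_prop

theorem abs_integral_sub_le {X : Type*} [MeasurableSpace X] {μ : Measure X}
    [IsProbabilityMeasure μ] {f : X → ℝ} (hf : Integrable f μ) {a C : ℝ}
    (h : ∀ᵐ x ∂μ, |f x - a| ≤ C) : |∫ x, f x ∂μ - a| ≤ C := by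
  have : ∫ x, f x ∂μ - a = ∫ x, (f x - a) ∂μ := by
    rw [integral_sub hf (integrable_const _)]
    simp
  rw [this, ← Real.norm_eq_abs]
  simpa using norm_integral_le_of_norm_le_const (f := fun x => f x - a) h

theorem integrable_of_abs_sub_le {X : Type*} [MeasurableSpace X] (μ : Measure X)
    [IsFiniteMeasure μ] {f : X → ℝ} (hf : Measurable f) {C : ℝ}
    (h : ∀ x y, |f x - f y| ≤ C) : Integrable f μ := by
  rcases isEmpty_or_nonempty X with hX | ⟨⟨x₀⟩⟩
  · rw [Measure.eq_zero_of_isEmpty μ]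
    exact integrable_zero_measure
  · refine Integrable.of_bound hf.aestronglyMeasurable (C + |f x₀|) (Eventually.of_forall fun x => ?_)
    rw [Real.norm_eq_abs]
    have h1 := abs_sub_abs_le_abs_sub (f x) (f x₀)
    linarith [h x x₀]

/-- Stationarity allows `f` to be replaced by its average over one step. Two points moved by the
same step approach each other by the factor `1 - s.1`, so each replacement multiplies the Lipschitz
constant by the mean of that factor. -/
theorem abs_integral_sub_integral_le_of_stationary {ρ : Measure (I × I)} [IsProbabilityMeasure ρ]
    {e : I → Fin N → ℝ} (he : Measurable e) {μ ν : Measure (Fin N → ℝ)} [IsProbabilityMeasure μ]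
    [IsProbabilityMeasure ν] (hμ : (ρ.prod μ).map (stickMap e) = μ)
    (hν : (ρ.prod ν).map (stickMap e) = ν) (hμI : ∀ᵐ x ∂μ, dist x 0 ≤ 1)
    (hνI : ∀ᵐ x ∂ν, dist x 0 ≤ 1) (C : ℝ) (n : ℕ) : ∀ (f : (Fin N → ℝ) → ℝ) (K : ℝ),
    Measurable f → 0 ≤ K → (∀ x y, |f x - f y| ≤ K * dist x y) → (∀ x y, |f x - f y| ≤ C) →
      |∫ x, f x ∂μ - ∫ x, f x ∂ν| ≤ 2 * K * (∫ s : I × I, (1 - (s.1 : ℝ)) ∂ρ) ^ n := by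
  induction n with
  | zero =>
    intro f K hf hK hL hC
    have h : ∀ (m : Measure (Fin N → ℝ)) [IsProbabilityMeasure m], (∀ᵐ x ∂m, dist x 0 ≤ 1) →
        |∫ x, f x ∂m - f 0| ≤ K := fun m _ hm => by
      refine abs_integral_sub_le (integrable_of_abs_sub_le m hf hC) ?_
      filter_upwards [hm] with x hx
      exact (hL x 0).trans (mul_le_of_le_one_right hK hx)
    have h1 := abs_le.1 (h μ hμI)
    have h2 := abs_le.1 (h ν hνI)
    rw [pow_zero, mul_one, abs_le]
    constructor <;> linarith [h1.1, h1.2, h2.1, h2.2]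
  | succ n ih =>
    intro f K hf hK hL hC
    have hmeas : Measurable fun q : (I × I) × (Fin N → ℝ) => f (stickMap e q) :=
      hf.comp (measurable_stickMap he)
    have hint : ∀ x, Integrable (fun s => f (stickMap e (s, x))) ρ := fun x =>
      integrable_of_abs_sub_le ρ (hmeas.comp measurable_prodMk_right) fun s s' => hC _ _
    have hstat : ∀ (m : Measure (Fin N → ℝ)) [IsProbabilityMeasure m],
        (ρ.prod m).map (stickMap e) = m →
        ∫ x, f x ∂m = ∫ x, ∫ s, f (stickMap e (s, x)) ∂ρ ∂m := fun m _ hm => by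
      conv_lhs => rw [← hm]
      rw [integral_map (measurable_stickMap he).aemeasurable hf.aestronglyMeasurable,
        integral_prod_symm _ (integrable_of_abs_sub_le _ hmeas fun q q' => hC _ _)]
    have hsub : ∀ x y, ∫ s, f (stickMap e (s, x)) ∂ρ - ∫ s, f (stickMap e (s, y)) ∂ρ =
        ∫ s, (f (stickMap e (s, x)) - f (stickMap e (s, y))) ∂ρ := fun x y =>
      (integral_sub (hint x) (hint y)).symm
    have hm1 : Measurable fun s : I × I => 1 - (s.1 : ℝ) := by fun_prop
    have hi1 : Integrable (fun s : I × I => 1 - (s.1 : ℝ)) ρ :=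
      Integrable.of_bound hm1.aestronglyMeasurable 1 (Eventually.of_forall fun s => by
        rw [Real.norm_eq_abs, abs_of_nonneg (one_sub_coe_nonneg _)]
        linarith [s.1.2.1])
    have hr0 : 0 ≤ ∫ s : I × I, (1 - (s.1 : ℝ)) ∂ρ :=
      integral_nonneg fun s => one_sub_coe_nonneg _
    rw [hstat μ hμ, hstat ν hν]
    refine (ih (fun x => ∫ s, f (stickMap e (s, x)) ∂ρ)
      (K * ∫ s : I × I, (1 - (s.1 : ℝ)) ∂ρ) ?_ (by positivity) ?_ ?_).trans_eq (by ring)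
    · exact (hmeas.stronglyMeasurable.integral_prod_left').measurable
    · intro x y
      rw [hsub]
      refine abs_integral_le_integral_abs.trans ?_
      calc _ ≤ ∫ s : I × I, (1 - (s.1 : ℝ)) * (K * dist x y) ∂ρ := by
            refine integral_mono_of_nonneg (Eventually.of_forall fun s => abs_nonneg _)
              (hi1.mul_const _) (Eventually.of_forall fun s => (hL _ _).trans_eq ?_)
            rw [stickMap, stickMap, dist_add_left, dist_smul₀, Real.norm_eq_abs,
              abs_of_nonneg (one_sub_coe_nonneg _)]
            ring
        _ = _ := by
            rw [integral_mul_const]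
            ring
    · intro x y
      rw [hsub, ← Real.norm_eq_abs]
      simpa using norm_integral_le_of_norm_le_const (μ := ρ)
        (f := fun s => f (stickMap e (s, x)) - f (stickMap e (s, y)))
        (Eventually.of_forall fun s => hC _ _)

theorem eq_of_stationary {ρ : Measure (I × I)} [IsProbabilityMeasure ρ]
    (hρ : ∫ s : I × I, (1 - (s.1 : ℝ)) ∂ρ < 1)
    {e : I → Fin N → ℝ} (he : Measurable e) {μ ν : Measure (Fin N → ℝ)} [IsProbabilityMeasure μ]
    [IsProbabilityMeasure ν] (hμ : (ρ.prod μ).map (stickMap e) = μ)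
    (hν : (ρ.prod ν).map (stickMap e) = ν) (hμI : ∀ᵐ x ∂μ, dist x 0 ≤ 1)
    (hνI : ∀ᵐ x ∂ν, dist x 0 ≤ 1) : μ = ν := by
  have hr0 : 0 ≤ ∫ s : I × I, (1 - (s.1 : ℝ)) ∂ρ := integral_nonneg fun s => one_sub_coe_nonneg _
  have key : ∀ f : (Fin N → ℝ) → ℝ, (∃ C, ∀ x y, dist (f x) (f y) ≤ C) →
      (∃ L, LipschitzWith L f) → ∫ x, f x ∂μ = ∫ x, f x ∂ν := by
    rintro f ⟨C, hC⟩ ⟨L, hL⟩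
    have hbound := fun n => abs_integral_sub_integral_le_of_stationary he hμ hν hμI hνI C n f L
      hL.continuous.measurable L.2 (fun x y => hL.dist_le_mul x y) hC
    have hlim : Tendsto (fun n : ℕ => 2 * (L : ℝ) * (∫ s : I × I, (1 - (s.1 : ℝ)) ∂ρ) ^ n) atTop
        (𝓝 0) := by
      simpa using (tendsto_pow_atTop_nhds_zero_of_lt_one hr0 hρ).const_mul (2 * (L : ℝ))
    have h0 := ge_of_tendsto' hlim hbound
    exact sub_eq_zero.1 (abs_eq_zero.1 (le_antisymm h0 (abs_nonneg _)))
  let μ' : ProbabilityMeasure (Fin N → ℝ) := ⟨μ, inferInstance⟩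
  let ν' : ProbabilityMeasure (Fin N → ℝ) := ⟨ν, inferInstance⟩
  -- Bounded Lipschitz functions determine the weak topology, so the constant sequence `μ'`
  -- converges to `ν'`; limits are unique.
  have h : Tendsto (fun _ : ℕ => μ') atTop (𝓝 ν') := by
    rw [tendsto_iff_forall_lipschitz_integral_tendsto]
    intro f hf hL
    have := key f hf hL
    change Tendsto (fun _ : ℕ => ∫ x, f x ∂μ) atTop (𝓝 (∫ x, f x ∂ν))
    rw [this]
    exact tendsto_const_nhds
  exact congrArg (fun m : ProbabilityMeasure (Fin N → ℝ) => (m : Measure (Fin N → ℝ)))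
    (tendsto_nhds_unique tendsto_const_nhds h)

end Uniqueness

/-! ### Values at partition points: Dirichlet stationarity and identification. -/

section Partition

variable {N : ℕ} {t : Fin (N + 2) → I}

/-- The values at the interior partition points of the distribution function of the unit mass
at `u`. -/
noncomputable def partitionIndicator (t : Fin (N + 2) → I) (u : I) : Fin N → ℝ :=
  fun j => if u ≤ t j.succ.castSucc then 1 else 0

theorem measurable_partitionIndicator (t : Fin (N + 2) → I) :
    Measurable (partitionIndicator t) :=
  measurable_pi_lambda _ fun _ => Measurable.ite measurableSet_Iic measurable_const measurable_const

theorem partitionIndicator_of_mem (ht : StrictMono t) {i : Fin (N + 1)} {u : I}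
    (hu : u ∈ Ioc (t i.castSucc) (t i.succ)) : partitionIndicator t u = simplexVertex i := by
  ext j
  rw [partitionIndicator, simplexVertex]
  congr 1
  rw [eq_iff_iff, Fin.le_castSucc_iff]
  constructor
  · intro h
    exact Fin.castSucc_lt_castSucc_iff.1 (ht.lt_iff_lt.1 (hu.1.trans_le h))
  · intro h
    refine hu.2.trans (ht.monotone ?_)
    rw [← Fin.succ_castSucc, Fin.succ_le_succ_iff, Fin.le_castSucc_iff]
    exact h

theorem iUnion_Ioc_partition (h0 : t 0 = 0) (h1 : t (Fin.last (N + 1)) = 1) :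
    ⋃ i : Fin (N + 1), Ioc (t i.castSucc) (t i.succ) = Ioi 0 := by
  refine Subset.antisymm (iUnion_subset fun i u hu => ?_) fun u hu => ?_
  · exact lt_of_le_of_lt (t i.castSucc).2.1 hu.1
  · have hne : ∃ k, u ≤ t k := ⟨Fin.last (N + 1), h1 ▸ u.2.2⟩
    classical
    -- The least partition point at or above `u` is the right end of its cell; it is not `t 0`,
    -- because `u > 0`.
    obtain ⟨k, hk, hmin⟩ := WellFounded.has_min (wellFounded_lt (α := Fin (N + 2)))
      {k | u ≤ t k} hne
    refine Fin.cases (motive := fun k => k ∈ {k | u ≤ t k} →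
      (∀ x ∈ {k | u ≤ t k}, ¬ x < k) → u ∈ _) ?_ (fun i => ?_) k hk hmin
    · intro hk _
      exact absurd (h0 ▸ hk : u ≤ 0) (not_le.2 hu)
    · intro hk hmin
      refine mem_iUnion.2 ⟨i, ?_, hk⟩
      by_contra hle
      exact hmin i.castSucc (not_lt.1 hle) (Fin.castSucc_lt_succ)

/-- A uniform location falls in the `i`-th half-open cell with probability equal to its length, and
there the indicator vector is the `i`-th vertex. The point `0`, outside all cells, is null. -/
theorem lintegral_partitionIndicator (ht : StrictMono t) (h0 : t 0 = 0)
    (h1 : t (Fin.last (N + 1)) = 1) (h : (Fin N → ℝ) → ℝ≥0∞) :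
    ∫⁻ u, h (partitionIndicator t u) =
      ∑ i : Fin (N + 1), ENNReal.ofReal ((t i.succ : ℝ) - t i.castSucc) * h (simplexVertex i) := by
  have hd : Pairwise (Function.onFun Disjoint
      fun i : Fin (N + 1) => Ioc (t i.castSucc) (t i.succ)) := by
    have hlt : ∀ i j : Fin (N + 1), i < j →
        Disjoint (Ioc (t i.castSucc) (t i.succ)) (Ioc (t j.castSucc) (t j.succ)) := by
      intro i j hij
      refine Set.disjoint_left.2 fun u hu hu' => ?_
      have : t i.succ ≤ t j.castSucc := ht.monotone (Fin.succ_le_castSucc_iff.2 hij)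
      exact absurd (hu.2.trans this) (not_le.2 hu'.1)
    intro i j hij
    rcases lt_or_gt_of_ne hij with h | h
    · exact hlt i j h
    · exact (hlt j i h).symm
  have hae : (Ioi (0 : I) : Set I) =ᵐ[volume] (univ : Set I) := by
    rw [ae_eq_univ, compl_Ioi]
    simp
  rw [← setLIntegral_univ, ← setLIntegral_congr hae, ← iUnion_Ioc_partition h0 h1,
    lintegral_iUnion (fun i => measurableSet_Ioc) hd, tsum_fintype]
  refine Finset.sum_congr rfl fun i _ => ?_
  rw [setLIntegral_congr_fun measurableSet_Ioc (g := fun _ => h (simplexVertex i)) fun u hu => by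
    rw [partitionIndicator_of_mem ht hu], setLIntegral_const, unitInterval.volume_Ioc, mul_comm]

theorem sum_partition (β : ℝ) (h0 : t 0 = 0) (h1 : t (Fin.last (N + 1)) = 1) :
    ∑ i : Fin (N + 1), β * ((t i.succ : ℝ) - t i.castSucc) = β := by
  rw [← Finset.mul_sum, Finset.sum_sub_distrib]
  have e1 := Fin.sum_univ_succ fun i => (t i : ℝ)
  have e2 := Fin.sum_univ_castSucc fun i => (t i : ℝ)
  rw [h0] at e1
  rw [h1] at e2
  have : ∑ i : Fin (N + 1), (t i.succ : ℝ) - ∑ i : Fin (N + 1), (t i.castSucc : ℝ) = 1 := by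
    simp only [Icc.coe_zero, Icc.coe_one] at e1 e2
    linarith
  rw [this, mul_one]

/-- The Dirichlet distribution with parameters `α`. -/
noncomputable def dirichletMeasure (α : Fin (N + 1) → ℝ) : Measure (Fin N → ℝ) :=
  (∫⁻ x, dirichletWeight α x)⁻¹ • volume.withDensity (dirichletWeight α)

theorem lintegral_dirichletWeight_pos_finite {α : Fin (N + 1) → ℝ} (hα : ∀ i, 0 < α i) :
    ∫⁻ x, dirichletWeight α x ≠ 0 ∧ ∫⁻ x, dirichletWeight α x ≠ ⊤ := by
  rw [lintegral_dirichletWeight α hα]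
  refine ⟨?_, ENNReal.ofReal_ne_top⟩
  rw [Ne, ENNReal.ofReal_eq_zero, not_le]
  exact div_pos (Finset.prod_pos fun i _ => Real.Gamma_pos_of_pos (hα i))
    (Real.Gamma_pos_of_pos (Finset.sum_pos (fun i _ => hα i) Finset.univ_nonempty))

theorem isProbabilityMeasure_dirichletMeasure {α : Fin (N + 1) → ℝ} (hα : ∀ i, 0 < α i) :
    IsProbabilityMeasure (dirichletMeasure α) := by
  constructor
  obtain ⟨h0, h1⟩ := lintegral_dirichletWeight_pos_finite hα
  rw [dirichletMeasure, Measure.smul_apply, withDensity_apply _ MeasurableSet.univ,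
    setLIntegral_univ, smul_eq_mul, ENNReal.inv_mul_cancel h0 h1]

theorem dist_zero_le_one_of_mem_openSimplex {x : Fin N → ℝ} (hx : x ∈ openSimplex N) :
    dist x 0 ≤ 1 := by
  have hm : StrictMono (extendEnds x) := hx
  rw [dist_pi_le_iff zero_le_one]
  intro j
  have h1 := hm.monotone (Fin.zero_le j.succ.castSucc)
  have h2 := hm.monotone (Fin.le_last j.succ.castSucc)
  rw [extendEnds_zero, extendEnds_castSucc_succ] at h1
  rw [extendEnds_last, extendEnds_castSucc_succ] at h2
  rw [Pi.zero_apply, Real.dist_eq, sub_zero, abs_of_nonneg h1]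
  exact h2

theorem dirichletMeasure_ae_dist_le (α : Fin (N + 1) → ℝ) :
    ∀ᵐ x ∂dirichletMeasure α, dist x 0 ≤ 1 := by
  refine Measure.ae_smul_measure ?_ _
  rw [ae_withDensity_iff (measurable_dirichletWeight α)]
  refine Eventually.of_forall fun x hx => dist_zero_le_one_of_mem_openSimplex ?_
  rw [mem_openSimplex]
  intro i
  by_contra hle
  exact hx (dirichletWeight_eq_zero (not_lt.1 hle))

/-- With `α i = β (t i.succ - t i.castSucc)`, the `Beta(1, β)` density times the cell probabilities
is `α i (1 - v)^(∑ α - 1)`, exactly the kernel that reproduces the Dirichlet weight. -/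
theorem stationary_dirichletMeasure {β : ℝ} (hβ : 0 < β) (ht : StrictMono t) (h0 : t 0 = 0)
    (h1 : t (Fin.last (N + 1)) = 1) :
    ((stickLaw β).prod (dirichletMeasure fun i => β * ((t i.succ : ℝ) - t i.castSucc))).map
      (stickMap (partitionIndicator t)) =
      dirichletMeasure fun i => β * ((t i.succ : ℝ) - t i.castSucc) := by
  set α : Fin (N + 1) → ℝ := fun i => β * ((t i.succ : ℝ) - t i.castSucc) with hαdef
  have hα : ∀ i, 0 < α i := fun i => mul_pos hβ (sub_pos.2 (ht Fin.castSucc_lt_succ))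
  have hsum : ∑ i, α i = β := sum_partition β h0 h1
  have hprob := isProbabilityMeasure_dirichletMeasure hα
  have hprob' := isProbabilityMeasure_stickLaw hβ
  have hW := measurable_dirichletWeight α
  have hmap := measurable_stickMap (measurable_partitionIndicator t)
  ext A hA
  set F : (Fin N → ℝ) → ℝ≥0∞ := A.indicator 1 with hF
  have hFm : Measurable F := measurable_one.indicator hA
  have hpart := measurable_partitionIndicator t
  set H : ℝ → I → ℝ≥0∞ := fun v u =>
    ∫⁻ x, F (v • partitionIndicator t u + (1 - v) • x) * dirichletWeight α x with hH
  have hHm : Measurable (Function.uncurry H) := by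
    have : Measurable fun q : (ℝ × I) × (Fin N → ℝ) =>
        F (q.1.1 • partitionIndicator t q.1.2 + (1 - q.1.1) • q.2) * dirichletWeight α q.2 := by
      refine Measurable.mul (hFm.comp ?_) (hW.comp measurable_snd)
      have h1 : Measurable fun q : (ℝ × I) × (Fin N → ℝ) => partitionIndicator t q.1.2 :=
        hpart.comp (measurable_snd.comp measurable_fst)
      fun_prop
    exact this.lintegral_prod_right'
  have hFA : ∀ m : Measure (Fin N → ℝ), m A = ∫⁻ x, F x ∂m := fun m => by
    rw [hF, lintegral_indicator_one hA]
  have hFmap : Measurable fun q => F (stickMap (partitionIndicator t) q) := hFm.comp hmap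
  rw [hFA, hFA, lintegral_map hFm hmap, lintegral_prod _ hFmap.aemeasurable]
  have hinner : ∀ G : (Fin N → ℝ) → ℝ≥0∞, Measurable G → ∫⁻ x, G x ∂dirichletMeasure α =
      (∫⁻ x, dirichletWeight α x)⁻¹ * ∫⁻ x, G x * dirichletWeight α x := fun G hG => by
    rw [dirichletMeasure, lintegral_smul_measure, lintegral_withDensity_eq_lintegral_mul _ hW hG,
      smul_eq_mul]
    simp only [Pi.mul_apply, mul_comm]
  have hci : (∫⁻ x, dirichletWeight α x)⁻¹ ≠ ⊤ :=
    ENNReal.inv_ne_top.2 (lintegral_dirichletWeight_pos_finite hα).1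
  have hs : ∀ s : I × I, ∫⁻ x, F (stickMap (partitionIndicator t) (s, x)) ∂dirichletMeasure α =
      (∫⁻ x, dirichletWeight α x)⁻¹ * H s.1 s.2 := fun s => by
    rw [hinner (fun x => F (stickMap (partitionIndicator t) (s, x)))
      (hFmap.comp measurable_prodMk_left)]
    rfl
  simp_rw [hs]
  rw [lintegral_const_mul' _ _ hci, hinner F hFm, lintegral_stickLaw β hHm,
    ← lintegral_dirichletWeight_stick hα hFm]
  congr 1
  rw [← lintegral_finsetSum]
  · refine setLIntegral_congr_fun measurableSet_Ioo fun v hv => ?_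
    have hu : ∫⁻ u, H v u = ∑ i : Fin (N + 1), ENNReal.ofReal ((t i.succ : ℝ) - t i.castSucc) *
        ∫⁻ x, F (v • simplexVertex i + (1 - v) • x) * dirichletWeight α x :=
      lintegral_partitionIndicator ht h0 h1
        fun y => ∫⁻ x, F (v • y + (1 - v) • x) * dirichletWeight α x
    rw [hu, Finset.mul_sum, hsum]
    refine Finset.sum_congr rfl fun i _ => ?_
    rw [hαdef, ENNReal.ofReal_mul hβ.le, ENNReal.ofReal_mul hβ.le]
    ring
  · intro i _
    have hmi : Measurable fun v : ℝ =>
        ∫⁻ x, F (v • simplexVertex i + (1 - v) • x) * dirichletWeight α x := by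
      have : Measurable fun q : ℝ × (Fin N → ℝ) =>
          F (q.1 • simplexVertex i + (1 - q.1) • q.2) * dirichletWeight α q.2 :=
        Measurable.mul (hFm.comp (by fun_prop)) (hW.comp measurable_snd)
      exact this.lintegral_prod_right'
    fun_prop

/-- The values of the stick-breaking function at the interior partition points. -/
noncomputable def stickValues (t : Fin (N + 2) → I) (ω : ℕ → I × I) : Fin N → ℝ :=
  fun j => stickFun ω (t j.succ.castSucc)

theorem measurable_stickValues (t : Fin (N + 2) → I) : Measurable (stickValues t) :=
  measurable_pi_lambda _ fun _ => (MonotoneFun.measurable_eval _).comp measurable_stickFun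

theorem stickValues_consSeq (t : Fin (N + 2) → I) (s : I × I) (ω : ℕ → I × I) :
    stickValues t (consSeq s ω) = stickMap (partitionIndicator t) (s, stickValues t ω) := by
  ext j
  simp only [stickValues, stickFun_consSeq, stickMap, partitionIndicator, Pi.add_apply,
    Pi.smul_apply, smul_eq_mul]

/-- The stick-breaking function has Dirichlet distributed values. -/
theorem map_stickValues {β : ℝ} (hβ : 0 < β) (ht : StrictMono t) (h0 : t 0 = 0)
    (h1 : t (Fin.last (N + 1)) = 1) :
    (Measure.infinitePi fun _ : ℕ => stickLaw β).map (stickValues t) =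
      dirichletMeasure fun i => β * ((t i.succ : ℝ) - t i.castSucc) := by
  have hα : ∀ i : Fin (N + 1), 0 < β * ((t i.succ : ℝ) - t i.castSucc) := fun i =>
    mul_pos hβ (sub_pos.2 (ht Fin.castSucc_lt_succ))
  have hprob := isProbabilityMeasure_dirichletMeasure hα
  have hprob' := isProbabilityMeasure_stickLaw hβ
  have hX := measurable_stickValues t
  have hpart := measurable_partitionIndicator t
  have hmap := measurable_stickMap hpart
  have hL : IsProbabilityMeasure
      ((Measure.infinitePi fun _ : ℕ => stickLaw β).map (stickValues t)) :=
    Measure.isProbabilityMeasure_map hX.aemeasurable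
  refine eq_of_stationary (integral_stickLaw_lt_one hβ) hpart ?_
    (stationary_dirichletMeasure hβ ht h0 h1) ?_ (dirichletMeasure_ae_dist_le _)
  · have hprod := Measure.map_prod_map (stickLaw β) (Measure.infinitePi fun _ : ℕ => stickLaw β)
      measurable_id hX
    rw [Measure.map_id] at hprod
    rw [hprod, Measure.map_map hmap (measurable_id.prodMap hX)]
    conv_rhs => rw [← map_consSeq_infinitePi (stickLaw β), Measure.map_map hX measurable_consSeq]
    congr 1
    ext1 q
    exact (stickValues_consSeq t q.1 q.2).symm
  · rw [ae_map_iff hX.aemeasurable (measurableSet_le (by fun_prop) measurable_const)]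
    refine Eventually.of_forall fun ω => (dist_pi_le_iff zero_le_one).2 fun j => ?_
    rw [Pi.zero_apply, Real.dist_eq, sub_zero, stickValues, abs_of_nonneg (stickFun ω _).2.1]
    exact (stickFun ω _).2.2

theorem integral_dirichletMeasure {α : Fin (N + 1) → ℝ} (hα : ∀ i, 0 < α i)
    (u : (Fin N → ℝ) → ℝ) : ∫ x, u x ∂dirichletMeasure α =
      Real.Gamma (∑ i, α i) / (∏ i, Real.Gamma (α i)) *
        ∫ x in openSimplex N, u x * ∏ i, increment i x ^ (α i - 1) := by
  have hfin : ∀ x, dirichletWeight α x < ⊤ := fun x => by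
    refine ENNReal.prod_lt_top fun i _ => ?_
    rw [posPow]
    split_ifs
    · exact ENNReal.ofReal_lt_top
    · exact ENNReal.zero_lt_top
  rw [dirichletMeasure, integral_smul_measure, integral_withDensity_eq_integral_toReal_smul
    (measurable_dirichletWeight α) (Eventually.of_forall hfin), lintegral_dirichletWeight α hα,
    ENNReal.toReal_inv, ENNReal.toReal_ofReal, inv_div, smul_eq_mul,
    ← integral_indicator measurableSet_openSimplex]
  · congr 2
    ext x
    by_cases hx : x ∈ openSimplex N
    · rw [indicator_of_mem hx, smul_eq_mul, mul_comm, dirichletWeight, ENNReal.toReal_prod]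
      congr 1
      refine Finset.prod_congr rfl fun i _ => ?_
      have hi := mem_openSimplex.1 hx i
      rw [posPow_of_pos _ hi, ENNReal.toReal_ofReal (by positivity)]
    · rw [indicator_of_notMem hx]
      rw [mem_openSimplex] at hx
      push Not at hx
      obtain ⟨i, hi⟩ := hx
      rw [dirichletWeight_eq_zero hi]
      simp
  · exact (div_pos (Finset.prod_pos fun i _ => Real.Gamma_pos_of_pos (hα i))
      (Real.Gamma_pos_of_pos (Finset.sum_pos (fun i _ => hα i) Finset.univ_nonempty))).le

end Partition

/-! ### Existence of the entropic measure, and the theorem. -/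

theorem exists_isEntropicMeasure {β : ℝ} (hβ : 0 < β) :
    ∃ Q : ProbabilityMeasure MonotoneFun, IsEntropicMeasure β Q := by
  have hprob := isProbabilityMeasure_stickLaw hβ
  refine ⟨⟨(Measure.infinitePi fun _ : ℕ => stickLaw β).map stickFun,
    Measure.isProbabilityMeasure_map measurable_stickFun.aemeasurable⟩, ?_⟩
  intro N t ht h0 h1 u hu _
  have hα : ∀ i : Fin (N + 1), 0 < β * ((t i.succ : ℝ) - t i.castSucc) := fun i =>
    mul_pos hβ (sub_pos.2 (ht Fin.castSucc_lt_succ))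
  have hev : Measurable fun g : MonotoneFun => fun i : Fin N => (g (t i.succ.castSucc) : ℝ) :=
    measurable_pi_lambda _ fun _ => MonotoneFun.measurable_eval _
  have huev : Measurable fun g : MonotoneFun => u fun i : Fin N => (g (t i.succ.castSucc) : ℝ) :=
    hu.comp hev
  rw [ProbabilityMeasure.coe_mk, integral_map measurable_stickFun.aemeasurable
    huev.aestronglyMeasurable]
  have hI := integral_dirichletMeasure hα u
  rw [sum_partition β h0 h1, ← map_stickValues hβ ht h0 h1,
    integral_map (measurable_stickValues t).aemeasurable hu.aestronglyMeasurable] at hI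
  exact hI

theorem mainTheorem1 (β : ℝ) (hβ : 0 < β) :
    (∃ Q : ProbabilityMeasure MonotoneFun, IsEntropicMeasure β Q) ∧
      ∀ Q : ProbabilityMeasure MonotoneFun, IsEntropicMeasure β Q →
        ¬ ∃ K : ℝ, HasGeneralizedRicciGE Q K :=
  ⟨exists_isEntropicMeasure hβ, fun _ hQ ⟨K, hK⟩ => hQ.not_hasGeneralizedRicciGE hβ K hK⟩
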